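/- Let $K$ be a field and let $E=(E^0,E^1,s,r)$ be a finite directed graph. The Leavitt path algebra $L_K(F)$ of a graph $F$ is the associative (not necessarily unital) $K$-algebra generated by the vertices $v\in F^0$ and symbols $e,e^*$ for $e\in F^1$, subject to the following relations: the vertices are orthogonal idempotents; $s(e)e=e=er(e)$ and $r(e)e^*=e^*=e^*s(e)$; $e^*e=r(e)$, and $e^*f=0$ for edges $e\ne f$; and $v=\sum_{s(e)=v}ee^*$ for every vertex $v$ that emits a nonempty finite set of edges. It is unital, with $1=\sum_{v\in F^0}v$, when $F^0$ is finite. Let $\tau\in E^1$ be a source loop at the vertex $t$: $s(\tau)=r(\tau)=t$, and $\tau$ is the only edge $e$ with $r(e)=t$. Put $H=E^0\setminus\{t\}$ (a hereditary set of vertices), let $E_H$ be the graph with vertex set $H$ and edge set $\{e\in E^1: s(e)\in H\}$, put $\rho=\sum_{u\in H}u\in L_K(E)$, and let $I=L_K(E)\,\rho\,L_K(E)$ be the two-sided ideal generated by $\rho$. Then: 1. The ideal $I$, viewed as a $K$-algebra in its own right, is isomorphic to the Leavitt path $K$-algebra of some (not necessarily finite) graph. Further, $I$ is Morita equivalent to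 $L_K(E_H)$: the category of unitary left $I$-modules (those $M$ with $IM=M$) is equivalent to the category of left $L_K(E_H)$-modules. 2. There is a lattice isomorphism between the lattice of left ideals of $L_K(E)$ contained in $I$ and the lattice of left $L_K(E_H)$-submodules of $\rho I$, where $L_K(E_H)$ acts on $\rho I$ by left multiplication through the canonical homomorphism $L_K(E_H)\to L_K(E)$. 3. Every left ideal of $L_K(E)$ properly containing $I$ is principal; it is generated by an element of the form $p(\tau)=p(0)1_{L_K(E)}+\sum_{i\ge1}a_i\tau^i$, where $p(x)=p(0)+\sum_{i\ge 1}a_ix^i\in K[x]$ has $p(0)=1$. -/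

import Mathlib

open CategoryTheory

universe u v w x

/-- A directed graph `(E⁰, E¹, s, r)`: a type `V` of vertices, a type `Ed` of edges, and the
source and range maps. -/
structure DirectedGraph (V : Type v) (Ed : Type w) where
  s : Ed → V
  r : Ed → V

namespace DirectedGraph

variable {V : Type v} {Ed : Type w}

/-- There is a finite path (possibly of length `0`) from `a` to `b`. -/
def Reaches (E : DirectedGraph V Ed) (a b : V) : Prop :=
  Relation.ReflTransGen (fun p q => ∃ e : Ed, E.s e = p ∧ E.r e = q) a b

/-- A set of vertices is hereditary if it contains every vertex reached by a path that starts
in it. -/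
def Hereditary (E : DirectedGraph V Ed) (H : Set V) : Prop :=
  ∀ a b : V, a ∈ H → E.Reaches a b → b ∈ H

/-- A source loop is a cycle `τ` of length one (`s(τ) = r(τ)`) without entrances: every edge whose
range is the base vertex of `τ` is equal to `τ`. -/
def IsSourceLoop (E : DirectedGraph V Ed) (τ : Ed) : Prop :=
  E.s τ = E.r τ ∧ ∀ e : Ed, E.r e = E.s τ → e = τ

theorem Hereditary.range_mem {E : DirectedGraph V Ed} {H : Set V} (hH : E.Hereditary H)
    {e : Ed} (he : E.s e ∈ H) : E.r e ∈ H :=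
  hH _ _ he (Relation.ReflTransGen.single ⟨e, rfl, rfl⟩)

theorem IsSourceLoop.hereditary {E : DirectedGraph V Ed} {τ : Ed} (hτ : E.IsSourceLoop τ) :
    E.Hereditary {E.s τ}ᶜ := by
  intro a b ha hab
  induction hab with
  | refl => exact ha
  | tail _ h ih =>
    obtain ⟨e, rfl, rfl⟩ := h
    intro hr
    have he := hτ.2 e hr
    subst he
    exact ih rfl

/-- The restriction `E_H` of `E` to a hereditary set `H` of vertices: its vertices are the
elements of `H`, its edges are the edges of `E` whose source lies in `H`. -/
def restrict (E : DirectedGraph V Ed) (H : Set V) (hH : E.Hereditary H) :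
    DirectedGraph H {e : Ed // E.s e ∈ H} where
  s e := ⟨E.s e.1, e.2⟩
  r e := ⟨E.r e.1, hH.range_mem e.2⟩

end DirectedGraph

/-- The generating symbols of the Leavitt path algebra: the vertices `v`, the edges `e` and the
ghost edges `e*`. -/
inductive LeavittGen (V : Type v) (Ed : Type w) : Type (max v w)
  | vert (a : V) : LeavittGen V Ed
  | edge (e : Ed) : LeavittGen V Ed
  | ghost (e : Ed) : LeavittGen V Ed

open LeavittGen

/-- A Cuntz-Krieger `E`-family in a (not necessarily unital) ring `A`. For graphs with infinitely
many edges the last relation is imposed, as usual, at the regular vertices, i.e. those that emit a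
nonempty finite set of edges; in a finite graph these are the vertices that are not sinks. -/
structure IsCuntzKriegerFamily {V : Type v} {Ed : Type w} (E : DirectedGraph V Ed)
    {A : Type x} [NonUnitalRing A] (f : LeavittGen V Ed → A) : Prop where
  vert_idem : ∀ a : V, f (vert a) * f (vert a) = f (vert a)
  vert_orth : ∀ a b : V, a ≠ b → f (vert a) * f (vert b) = 0
  source_edge : ∀ e : Ed, f (vert (E.s e)) * f (edge e) = f (edge e)
  edge_range : ∀ e : Ed, f (edge e) * f (vert (E.r e)) = f (edge e)
  range_ghost : ∀ e : Ed, f (vert (E.r e)) * f (ghost e) = f (ghost e)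
  ghost_source : ∀ e : Ed, f (ghost e) * f (vert (E.s e)) = f (ghost e)
  ghost_edge_self : ∀ e : Ed, f (ghost e) * f (edge e) = f (vert (E.r e))
  ghost_edge_ne : ∀ e e' : Ed, e ≠ e' → f (ghost e) * f (edge e') = 0
  regular_vert : ∀ (a : V) (hfin : (E.s ⁻¹' {a}).Finite), (E.s ⁻¹' {a}).Nonempty →
    f (vert a) = ∑ e ∈ hfin.toFinset, f (edge e) * f (ghost e)

noncomputable section

section LeavittPathAlgebra

variable (K : Type u) [Field K] {V : Type v} {Ed : Type w} (E : DirectedGraph V Ed)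

/-- The free associative (non-unital) `K`-algebra on the generating symbols: the semigroup algebra
of the free semigroup of nonempty words. -/
abbrev LeavittFree (V : Type v) (Ed : Type w) : Type (max u v w) :=
  MonoidAlgebra K (FreeSemigroup (LeavittGen V Ed))

/-- A generating symbol as an element of the free algebra. -/
def LeavittFree.gen (g : LeavittGen V Ed) : LeavittFree K V Ed :=
  MonoidAlgebra.single (FreeSemigroup.of g) 1

/-- The defining relations of the Leavitt path algebra. -/
inductive LeavittRel : LeavittFree K V Ed → LeavittFree K V Ed → Prop
  | vert_idem (a : V) : LeavittRel
      (LeavittFree.gen K (vert a) * LeavittFree.gen K (vert a)) (LeavittFree.gen K (vert a))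
  | vert_orth (a b : V) (h : a ≠ b) : LeavittRel
      (LeavittFree.gen K (vert a) * LeavittFree.gen K (vert b)) 0
  | source_edge (e : Ed) : LeavittRel
      (LeavittFree.gen K (vert (E.s e)) * LeavittFree.gen K (edge e)) (LeavittFree.gen K (edge e))
  | edge_range (e : Ed) : LeavittRel
      (LeavittFree.gen K (edge e) * LeavittFree.gen K (vert (E.r e))) (LeavittFree.gen K (edge e))
  | range_ghost (e : Ed) : LeavittRel
      (LeavittFree.gen K (vert (E.r e)) * LeavittFree.gen K (ghost e))
      (LeavittFree.gen K (ghost e))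
  | ghost_source (e : Ed) : LeavittRel
      (LeavittFree.gen K (ghost e) * LeavittFree.gen K (vert (E.s e)))
      (LeavittFree.gen K (ghost e))
  | ghost_edge_self (e : Ed) : LeavittRel
      (LeavittFree.gen K (ghost e) * LeavittFree.gen K (edge e)) (LeavittFree.gen K (vert (E.r e)))
  | ghost_edge_ne (e e' : Ed) (h : e ≠ e') : LeavittRel
      (LeavittFree.gen K (ghost e) * LeavittFree.gen K (edge e')) 0
  | regular_vert (a : V) (hfin : (E.s ⁻¹' {a}).Finite) (hne : (E.s ⁻¹' {a}).Nonempty) : LeavittRel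
      (LeavittFree.gen K (vert a))
      (∑ e ∈ hfin.toFinset, LeavittFree.gen K (edge e) * LeavittFree.gen K (ghost e))

/-- The smallest ring congruence containing all scalar multiples of the defining relations
(i.e. the `K`-algebra congruence generated by the defining relations). -/
def leavittCon : RingCon (LeavittFree K V Ed) :=
  ringConGen fun p q => ∃ (k : K) (p' q' : LeavittFree K V Ed),
    LeavittRel K E p' q' ∧ p = k • p' ∧ q = k • q'

theorem leavittCon_smul (k : K) {p q : LeavittFree K V Ed} (h : leavittCon K E p q) :
    leavittCon K E (k • p) (k • q) := by
  change RingConGen.Rel _ _ _ at h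
  induction h with
  | of p q h =>
    obtain ⟨l, p', q', h, rfl, rfl⟩ := h
    exact RingConGen.Rel.of _ _ ⟨k * l, p', q', h, smul_smul _ _ _, smul_smul _ _ _⟩
  | refl p => exact (leavittCon K E).refl _
  | symm _ ih => exact (leavittCon K E).symm ih
  | trans _ _ ih1 ih2 => exact (leavittCon K E).trans ih1 ih2
  | add _ _ ih1 ih2 =>
    rw [smul_add, smul_add]
    exact (leavittCon K E).add ih1 ih2
  | mul _ h2 ih1 _ =>
    rw [← smul_mul_assoc, ← smul_mul_assoc]
    exact (leavittCon K E).mul ih1 h2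

/-- The Leavitt path algebra `L_K(E)` of an arbitrary graph `E`: the free associative `K`-algebra
on the vertices, edges and ghost edges modulo the defining relations. It is in general not
unital. -/
def LeavittPathAlgebra : Type (max u v w) := (leavittCon K E).Quotient

namespace LeavittPathAlgebra

instance : NonUnitalRing (LeavittPathAlgebra K E) :=
  inferInstanceAs (NonUnitalRing (leavittCon K E).Quotient)

/-- The quotient map from the free algebra. -/
def mk (p : LeavittFree K V Ed) : LeavittPathAlgebra K E := (p : (leavittCon K E).Quotient)

variable {K E} in
theorem mk_surjective (a : LeavittPathAlgebra K E) : ∃ p, mk K E p = a :=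
  Quotient.exists_rep a

theorem mk_add (p q : LeavittFree K V Ed) : mk K E (p + q) = mk K E p + mk K E q := rfl

theorem mk_mul (p q : LeavittFree K V Ed) : mk K E (p * q) = mk K E p * mk K E q := rfl

theorem mk_zero : mk K E 0 = 0 := rfl

instance : SMul K (LeavittPathAlgebra K E) where
  smul k := Quotient.map (fun p : LeavittFree K V Ed => k • p)
    (fun _ _ h => leavittCon_smul K E k h)

theorem mk_smul (k : K) (p : LeavittFree K V Ed) : mk K E (k • p) = k • mk K E p := rfl

instance : Module K (LeavittPathAlgebra K E) :=
  Function.Surjective.module K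
    ({ toFun := mk K E, map_zero' := rfl, map_add' := mk_add K E } :
      LeavittFree K V Ed →+ LeavittPathAlgebra K E)
    mk_surjective (mk_smul K E)

instance : IsScalarTower K (LeavittPathAlgebra K E) (LeavittPathAlgebra K E) where
  smul_assoc k a b := by
    obtain ⟨p, rfl⟩ := mk_surjective a
    obtain ⟨q, rfl⟩ := mk_surjective b
    simp only [smul_eq_mul, ← mk_smul, ← mk_mul, smul_mul_assoc]

instance : SMulCommClass K (LeavittPathAlgebra K E) (LeavittPathAlgebra K E) where
  smul_comm k a b := by
    obtain ⟨p, rfl⟩ := mk_surjective a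
    obtain ⟨q, rfl⟩ := mk_surjective b
    simp only [smul_eq_mul, ← mk_smul, ← mk_mul, mul_smul_comm]

/-- A generating symbol as an element of `L_K(E)`. -/
def gen (g : LeavittGen V Ed) : LeavittPathAlgebra K E := mk K E (LeavittFree.gen K g)

/-- A vertex as an element of `L_K(E)`. -/
def ofVert (a : V) : LeavittPathAlgebra K E := gen K E (vert a)

/-- An edge as an element of `L_K(E)`. -/
def ofEdge (e : Ed) : LeavittPathAlgebra K E := gen K E (edge e)

theorem mk_eq_of_rel {p q : LeavittFree K V Ed} (h : LeavittRel K E p q) :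
    mk K E p = mk K E q :=
  (RingCon.eq _).2 (RingConGen.Rel.of _ _ ⟨1, p, q, h, (one_smul _ _).symm, (one_smul _ _).symm⟩)

theorem mk_sum {ι : Type*} (t : Finset ι) (p : ι → LeavittFree K V Ed) :
    mk K E (∑ i ∈ t, p i) = ∑ i ∈ t, mk K E (p i) :=
  map_sum ({ toFun := mk K E, map_zero' := rfl, map_add' := mk_add K E } :
      LeavittFree K V Ed →+ LeavittPathAlgebra K E) p t

theorem isCuntzKriegerFamily_gen : IsCuntzKriegerFamily E (gen K E) where
  vert_idem a := mk_eq_of_rel K E (.vert_idem a)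
  vert_orth a b h := mk_eq_of_rel K E (.vert_orth a b h)
  source_edge e := mk_eq_of_rel K E (.source_edge e)
  edge_range e := mk_eq_of_rel K E (.edge_range e)
  range_ghost e := mk_eq_of_rel K E (.range_ghost e)
  ghost_source e := mk_eq_of_rel K E (.ghost_source e)
  ghost_edge_self e := mk_eq_of_rel K E (.ghost_edge_self e)
  ghost_edge_ne e e' h := mk_eq_of_rel K E (.ghost_edge_ne e e' h)
  regular_vert a hfin hne := by
    refine (mk_eq_of_rel K E (.regular_vert a hfin hne)).trans ?_
    rw [mk_sum]
    rfl

theorem induction {P : LeavittPathAlgebra K E → Prop} (zero : P 0)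
    (add : ∀ a b, P a → P b → P (a + b)) (smul : ∀ (k : K) a, P a → P (k • a))
    (gen : ∀ g, P (gen K E g)) (gen_mul : ∀ g a, P a → P (LeavittPathAlgebra.gen K E g * a))
    (a : LeavittPathAlgebra K E) : P a := by
  have hword : ∀ m : FreeSemigroup (LeavittGen V Ed), P (mk K E (MonoidAlgebra.single m 1)) := by
    intro m
    induction m using FreeSemigroup.recOnMul with
    | ih1 g => exact gen g
    | ih2 g m _ ih =>
      have h : (MonoidAlgebra.single (FreeSemigroup.of g * m) 1 : LeavittFree K V Ed)
          = LeavittFree.gen K g * MonoidAlgebra.single m 1 := by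
        rw [LeavittFree.gen, MonoidAlgebra.single_mul_single, one_mul]
      rw [h, mk_mul]
      exact gen_mul g _ ih
  obtain ⟨p, rfl⟩ := mk_surjective a
  induction p using MonoidAlgebra.induction_linear with
  | zero => exact zero
  | add p q hp hq => exact add _ _ hp hq
  | single m k =>
    have h : (MonoidAlgebra.single m k : LeavittFree K V Ed)
        = k • MonoidAlgebra.single m 1 := by
      rw [MonoidAlgebra.smul_single, smul_eq_mul, mul_one]
    rw [h, mk_smul]
    exact smul _ _ (hword m)

section lift

variable {A : Type x} [NonUnitalRing A] [Module K A] [IsScalarTower K A A] [SMulCommClass K A A]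

/-- The homomorphism from the free algebra determined by the images of the generators. -/
def freeLift (f : LeavittGen V Ed → A) : LeavittFree K V Ed →ₙₐ[K] A :=
  MonoidAlgebra.liftMagma K (FreeSemigroup.lift f)

theorem freeLift_gen (f : LeavittGen V Ed → A) (g : LeavittGen V Ed) :
    freeLift K f (LeavittFree.gen K g) = f g := by
  simp [freeLift, LeavittFree.gen]

variable {E}

theorem freeLift_eq {f : LeavittGen V Ed → A} (hf : IsCuntzKriegerFamily E f)
    {p q : LeavittFree K V Ed} (h : leavittCon K E p q) : freeLift K f p = freeLift K f q := by
  change RingConGen.Rel _ _ _ at h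
  induction h with
  | of p q h =>
    obtain ⟨k, p', q', h, rfl, rfl⟩ := h
    rw [map_smul, map_smul]
    congr 1
    cases h with
    | vert_idem a => simpa [freeLift_gen] using hf.vert_idem a
    | vert_orth a b h => simpa [freeLift_gen] using hf.vert_orth a b h
    | source_edge e => simpa [freeLift_gen] using hf.source_edge e
    | edge_range e => simpa [freeLift_gen] using hf.edge_range e
    | range_ghost e => simpa [freeLift_gen] using hf.range_ghost e
    | ghost_source e => simpa [freeLift_gen] using hf.ghost_source e
    | ghost_edge_self e => simpa [freeLift_gen] using hf.ghost_edge_self e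
    | ghost_edge_ne e e' h => simpa [freeLift_gen] using hf.ghost_edge_ne e e' h
    | regular_vert a hfin hne =>
      simpa [freeLift_gen, map_sum] using hf.regular_vert a hfin hne
  | refl p => rfl
  | symm _ ih => exact ih.symm
  | trans _ _ ih1 ih2 => exact ih1.trans ih2
  | add _ _ ih1 ih2 => rw [map_add, map_add, ih1, ih2]
  | mul _ _ ih1 ih2 => rw [map_mul, map_mul, ih1, ih2]

/-- The homomorphism `L_K(E) → A` determined by a Cuntz-Krieger `E`-family in `A`. -/
def lift (f : LeavittGen V Ed → A) (hf : IsCuntzKriegerFamily E f) :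
    LeavittPathAlgebra K E →ₙₐ[K] A where
  toFun := Quotient.lift (freeLift K f) (fun _ _ h => freeLift_eq K hf h)
  map_smul' k a := by
    obtain ⟨p, rfl⟩ := mk_surjective a
    exact map_smul (freeLift K f) k p
  map_zero' := map_zero (freeLift K f)
  map_add' a b := by
    obtain ⟨p, rfl⟩ := mk_surjective a
    obtain ⟨q, rfl⟩ := mk_surjective b
    exact map_add (freeLift K f) p q
  map_mul' a b := by
    obtain ⟨p, rfl⟩ := mk_surjective a
    obtain ⟨q, rfl⟩ := mk_surjective b
    exact map_mul (freeLift K f) p q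

theorem lift_gen (f : LeavittGen V Ed → A) (hf : IsCuntzKriegerFamily E f) (g : LeavittGen V Ed) :
    lift K f hf (gen K E g) = f g :=
  freeLift_gen K f g

end lift

theorem exists_ofVert_mul_gen (g : LeavittGen V Ed) :
    ∃ a, ofVert K E a * gen K E g = gen K E g := by
  cases g with
  | vert a => exact ⟨a, (isCuntzKriegerFamily_gen K E).vert_idem a⟩
  | edge e => exact ⟨E.s e, (isCuntzKriegerFamily_gen K E).source_edge e⟩
  | ghost e => exact ⟨E.r e, (isCuntzKriegerFamily_gen K E).range_ghost e⟩

theorem exists_gen_mul_ofVert (g : LeavittGen V Ed) :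
    ∃ a, gen K E g * ofVert K E a = gen K E g := by
  cases g with
  | vert a => exact ⟨a, (isCuntzKriegerFamily_gen K E).vert_idem a⟩
  | edge e => exact ⟨E.r e, (isCuntzKriegerFamily_gen K E).edge_range e⟩
  | ghost e => exact ⟨E.s e, (isCuntzKriegerFamily_gen K E).ghost_source e⟩

section FiniteVertices

variable [Finite V]

/-- The sum of the vertices in `H`, as an element of `L_K(E)`. -/
def vertexSum (H : Set V) : LeavittPathAlgebra K E := ∑ a ∈ H.toFinite.toFinset, ofVert K E a

theorem vertexSum_mul_ofVert (H : Set V) {a : V} (ha : a ∈ H) :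
    vertexSum K E H * ofVert K E a = ofVert K E a := by
  rw [vertexSum, Finset.sum_mul, Finset.sum_eq_single a]
  · exact (isCuntzKriegerFamily_gen K E).vert_idem a
  · intro b _ hb
    exact (isCuntzKriegerFamily_gen K E).vert_orth b a hb
  · intro h
    exact absurd (H.toFinite.mem_toFinset.2 ha) h

theorem ofVert_mul_vertexSum (H : Set V) {a : V} (ha : a ∈ H) :
    ofVert K E a * vertexSum K E H = ofVert K E a := by
  rw [vertexSum, Finset.mul_sum, Finset.sum_eq_single a]
  · exact (isCuntzKriegerFamily_gen K E).vert_idem a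
  · intro b _ hb
    exact (isCuntzKriegerFamily_gen K E).vert_orth a b hb.symm
  · intro h
    exact absurd (H.toFinite.mem_toFinset.2 ha) h

theorem vertexSum_mul_self (H : Set V) :
    vertexSum K E H * vertexSum K E H = vertexSum K E H := by
  conv_lhs => enter [2]; rw [vertexSum]
  rw [Finset.mul_sum]
  conv_rhs => rw [vertexSum]
  exact Finset.sum_congr rfl fun a ha =>
    vertexSum_mul_ofVert K E H (H.toFinite.mem_toFinset.1 ha)

theorem vertexSum_univ_mul_gen (g : LeavittGen V Ed) :
    vertexSum K E Set.univ * gen K E g = gen K E g := by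
  obtain ⟨a, ha⟩ := exists_ofVert_mul_gen K E g
  rw [← ha, ← mul_assoc, vertexSum_mul_ofVert K E _ (Set.mem_univ a)]

theorem gen_mul_vertexSum_univ (g : LeavittGen V Ed) :
    gen K E g * vertexSum K E Set.univ = gen K E g := by
  obtain ⟨a, ha⟩ := exists_gen_mul_ofVert K E g
  rw [← ha, mul_assoc, ofVert_mul_vertexSum K E _ (Set.mem_univ a)]

/-- If `E` has finitely many vertices, then `L_K(E)` is unital; its identity is the sum of all
vertices. -/
instance : Ring (LeavittPathAlgebra K E) where
  __ := (inferInstance : NonUnitalRing (LeavittPathAlgebra K E))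
  one := vertexSum K E Set.univ
  one_mul a := by
    change vertexSum K E Set.univ * a = a
    induction a using LeavittPathAlgebra.induction with
    | zero => exact mul_zero _
    | add a b ha hb => rw [mul_add, ha, hb]
    | smul k a ha => rw [mul_smul_comm, ha]
    | gen g => exact vertexSum_univ_mul_gen K E g
    | gen_mul g a _ => rw [← mul_assoc, vertexSum_univ_mul_gen]
  mul_one a := by
    change a * vertexSum K E Set.univ = a
    induction a using LeavittPathAlgebra.induction with
    | zero => exact zero_mul _
    | add a b ha hb => rw [add_mul, ha, hb]
    | smul k a ha => rw [smul_mul_assoc, ha]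
    | gen g => exact gen_mul_vertexSum_univ K E g
    | gen_mul g a ha => rw [mul_assoc, ha]

theorem one_def : (1 : LeavittPathAlgebra K E) = vertexSum K E Set.univ := rfl

instance : Algebra K (LeavittPathAlgebra K E) :=
  Algebra.ofModule smul_mul_assoc mul_smul_comm

/-- The two-sided ideal of `L_K(E)` generated by the sum of the vertices in `H`. -/
def vertexIdeal (H : Set V) : TwoSidedIdeal (LeavittPathAlgebra K E) :=
  TwoSidedIdeal.span {vertexSum K E H}

/-- The two-sided ideal generated by the sum of the vertices in `H`, as a (not necessarily unital)
`K`-algebra. -/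
def vertexIdealAlgebra (H : Set V) : NonUnitalSubalgebra K (LeavittPathAlgebra K E) where
  carrier := vertexIdeal K E H
  add_mem' ha hb := (vertexIdeal K E H).add_mem ha hb
  zero_mem' := (vertexIdeal K E H).zero_mem
  mul_mem' {a b} _ hb := (vertexIdeal K E H).mul_mem_left a b hb
  smul_mem' k a ha := by
    rw [Algebra.smul_def]
    exact (vertexIdeal K E H).mul_mem_left _ a ha

end FiniteVertices

section Restrict

variable {K E}
variable {H : Set V} (hH : E.Hereditary H)

/-- The inclusion of the generating symbols of `E_H` into those of `E`. -/
def restrictGen : LeavittGen H {e : Ed // E.s e ∈ H} → LeavittGen V Ed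
  | vert a => vert a.1
  | edge e => edge e.1
  | ghost e => ghost e.1

variable (K) in
theorem isCuntzKriegerFamily_restrict :
    IsCuntzKriegerFamily (E.restrict H hH) (fun g => gen K E (restrictGen g)) where
  vert_idem a := (isCuntzKriegerFamily_gen K E).vert_idem a.1
  vert_orth a b h := (isCuntzKriegerFamily_gen K E).vert_orth a.1 b.1 (fun h' => h (Subtype.ext h'))
  source_edge e := (isCuntzKriegerFamily_gen K E).source_edge e.1
  edge_range e := (isCuntzKriegerFamily_gen K E).edge_range e.1
  range_ghost e := (isCuntzKriegerFamily_gen K E).range_ghost e.1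
  ghost_source e := (isCuntzKriegerFamily_gen K E).ghost_source e.1
  ghost_edge_self e := (isCuntzKriegerFamily_gen K E).ghost_edge_self e.1
  ghost_edge_ne e e' h :=
    (isCuntzKriegerFamily_gen K E).ghost_edge_ne e.1 e'.1 (fun h' => h (Subtype.ext h'))
  regular_vert a hfin hne := by
    have himg : E.s ⁻¹' {a.1} = Subtype.val '' ((E.restrict H hH).s ⁻¹' {a}) := by
      ext e
      constructor
      · intro he
        have he' : E.s e = a.1 := he
        exact ⟨⟨e, he' ▸ a.2⟩, Subtype.ext he', rfl⟩
      · rintro ⟨e', he', rfl⟩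
        exact congrArg Subtype.val (show (E.restrict H hH).s e' = a from he')
    have hfin' : (E.s ⁻¹' {a.1}).Finite := himg ▸ hfin.image _
    refine ((isCuntzKriegerFamily_gen K E).regular_vert a.1 hfin' (himg ▸ hne.image _)).trans ?_
    symm
    refine Finset.sum_bij (fun e _ => e.1) ?_ ?_ ?_ ?_
    · intro e he
      rw [Set.Finite.mem_toFinset] at he ⊢
      rw [himg]
      exact ⟨e, he, rfl⟩
    · intro e _ e' _ h
      exact Subtype.ext h
    · intro e he
      rw [Set.Finite.mem_toFinset, himg] at he
      obtain ⟨e', he', rfl⟩ := he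
      exact ⟨e', hfin.mem_toFinset.2 he', rfl⟩
    · intro e _
      rfl

variable (K) in
/-- The canonical homomorphism `L_K(E_H) → L_K(E)`, which sends every vertex, edge and ghost edge
of `E_H` to itself. -/
def restrictHom : LeavittPathAlgebra K (E.restrict H hH) →ₙₐ[K] LeavittPathAlgebra K E :=
  lift K (fun g => gen K E (restrictGen g)) (isCuntzKriegerFamily_restrict K hH)

variable [Finite V]

theorem restrictHom_one : restrictHom K hH 1 = vertexSum K E H := by
  rw [one_def, vertexSum, vertexSum, map_sum]
  refine Finset.sum_bij (fun a _ => a.1) ?_ ?_ ?_ ?_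
  · intro a _
    exact H.toFinite.mem_toFinset.2 a.2
  · intro a _ b _ h
    exact Subtype.ext h
  · intro a ha
    exact ⟨⟨a, H.toFinite.mem_toFinset.1 ha⟩, by simp, rfl⟩
  · intro a _
    exact lift_gen K _ _ _

variable (K E) in
/-- The subgroup `ρI = {ρ y : y ∈ I}` of `L_K(E)`, where `ρ` is the sum of the vertices in `H` and
`I` is the two-sided ideal generated by `ρ`. -/
def vertexSumIdeal (H : Set V) : AddSubgroup (LeavittPathAlgebra K E) where
  carrier := {z | ∃ y ∈ vertexIdeal K E H, z = vertexSum K E H * y}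
  add_mem' := by
    rintro _ _ ⟨y, hy, rfl⟩ ⟨y', hy', rfl⟩
    exact ⟨y + y', (vertexIdeal K E H).add_mem hy hy', (mul_add _ _ _).symm⟩
  zero_mem' := ⟨0, (vertexIdeal K E H).zero_mem, (mul_zero _).symm⟩
  neg_mem' := by
    rintro _ ⟨y, hy, rfl⟩
    exact ⟨-y, (vertexIdeal K E H).neg_mem hy, (mul_neg _ _).symm⟩

theorem restrictHom_mul_mem (a : LeavittPathAlgebra K (E.restrict H hH))
    {z : LeavittPathAlgebra K E} (hz : z ∈ vertexSumIdeal K E H) :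
    restrictHom K hH a * z ∈ vertexSumIdeal K E H := by
  obtain ⟨y, hy, rfl⟩ := hz
  refine ⟨restrictHom K hH a * (vertexSum K E H * y), ?_, ?_⟩
  · exact (vertexIdeal K E H).mul_mem_left _ _ ((vertexIdeal K E H).mul_mem_left _ _ hy)
  · rw [← mul_assoc (vertexSum K E H) (restrictHom K hH a), ← restrictHom_one hH, ← map_mul,
      one_mul]

/-- `ρI` as a left `L_K(E_H)`-module: `L_K(E_H)` acts by left multiplication in `L_K(E)`, through
the canonical homomorphism `L_K(E_H) → L_K(E)`. -/
instance : Module (LeavittPathAlgebra K (E.restrict H hH)) (vertexSumIdeal K E H) where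
  smul a z := ⟨restrictHom K hH a * z.1, restrictHom_mul_mem hH a z.2⟩
  one_smul z := by
    obtain ⟨_, y, hy, rfl⟩ := z
    refine Subtype.ext ?_
    change restrictHom K hH 1 * (vertexSum K E H * y) = vertexSum K E H * y
    rw [restrictHom_one, ← mul_assoc, vertexSum_mul_self]
  mul_smul a b z := Subtype.ext (by
    change restrictHom K hH (a * b) * z.1 = restrictHom K hH a * (restrictHom K hH b * z.1)
    rw [map_mul, mul_assoc])
  smul_zero a := Subtype.ext (mul_zero _)
  smul_add a z z' := Subtype.ext (mul_add _ _ _)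
  add_smul a b z := Subtype.ext (by
    change restrictHom K hH (a + b) * z.1 = restrictHom K hH a * z.1 + restrictHom K hH b * z.1
    rw [map_add, add_mul])
  zero_smul z := Subtype.ext (by
    change restrictHom K hH 0 * z.1 = 0
    rw [map_zero, zero_mul])

end Restrict

end LeavittPathAlgebra

end LeavittPathAlgebra

/-- A unitary left module over a not necessarily unital ring `A`: an abelian group `M` with a
biadditive associative action of `A` such that `A M = M`. -/
structure UnitaryModuleCat (A : Type u) [NonUnitalRing A] where
  carrier : Type w
  [addCommGroup : AddCommGroup carrier]
  act : A →ₙ+* AddMonoid.End carrier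
  unitary : AddSubgroup.closure {m : carrier | ∃ (a : A) (n : carrier), m = act a n} = ⊤

namespace UnitaryModuleCat

attribute [instance] UnitaryModuleCat.addCommGroup

variable {A : Type u} [NonUnitalRing A]

/-- Homomorphisms of unitary left `A`-modules. -/
@[ext]
structure Hom (M N : UnitaryModuleCat.{u, w} A) where
  toAddMonoidHom : M.carrier →+ N.carrier
  map_act : ∀ (a : A) (m : M.carrier), toAddMonoidHom (M.act a m) = N.act a (toAddMonoidHom m)

/-- The category of unitary left `A`-modules. -/
instance : Category.{w} (UnitaryModuleCat.{u, w} A) where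
  Hom M N := Hom M N
  id M := ⟨AddMonoidHom.id _, fun _ _ => rfl⟩
  comp f g := ⟨g.toAddMonoidHom.comp f.toAddMonoidHom, fun a m => by
    rw [AddMonoidHom.comp_apply, AddMonoidHom.comp_apply, f.map_act, g.map_act]⟩

end UnitaryModuleCat

end

/-! Write L = L_K(E), R = L_K(E_H), and let φ : R → L be the canonical map, so that φ(1) = ρ. The
only edge entering t is τ, so the paths from t that reach H by their last edge are exactly the τ^n f
with f an exit of τ. Together with ρ these paths form a family x, with ghost paths y. The products
x_k y_k are orthogonal idempotents, their finite sums are local units of I, and y_k I x_l lies in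
ρLρ = φ(R). Thus I behaves like an algebra of finite matrices over R; `IsCornerFrame` isolates
exactly this situation, and `exit_isCornerFrame` establishes it.

Such a frame gives the first two claims. For the graph, attach to E_H one new vertex for each τ^n f,
emitting a single edge to r(f). The Leavitt path algebra of this hedgehog graph has a frame over R
of the same shape (`hedgehog_isCornerFrame`), and a homomorphism that matches two frames is
bijective once the target corner is a faithful copy of R (`IsCornerFrame.bijective`). For Morita
equivalence, M ↦ ρM is faithful and full because m = ∑ x_k (y_k m). It is essentially surjective
because every R-module N induces an explicit L-module (`ExitModule`) whose ρ-corner is N. Taking N =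
R there also proves that φ is injective. For left ideals, J ↦ J ∩ ρI is inverse to N ↦ LN, again by
j = ∑ x_k (y_k j) and ρLρ = φ(R).

For the last claim, τ becomes invertible in L/I with inverse τ*, and every class becomes polynomial
in τ after multiplication by a power of τ. Hence J is governed by the ideal of those p in K[x] with
p(τ) ∈ J. It is generated by some q, and q(0) ≠ 0 because x can be cancelled; normalise q(0) = 1.
Finally I ⊆ L p(τ) whenever p(0) = 1 (`vertexIdeal_le_span_aeval`), since right multiplication by τ
shortens the ghost paths y_k until it kills them. -/

open Filter

/-! ### Corner frames and homomorphisms between them. -/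

/-- Morita data between a unital ring `R` and a not necessarily unital ring `B`: a homomorphism
`φ : R → B` onto the corner `φ(1) B φ(1)` and families `x`, `y` in `B φ(1)`, `φ(1) B` such that the
finite partial sums of `∑ x k * y k` are local units of `B`. -/
structure IsCornerFrame {R B ι : Type*} [Ring R] [NonUnitalRing B] (φ : R →ₙ+* B)
    (x y : ι → B) : Prop where
  x_corner : ∀ k, x k * φ 1 = x k
  corner_y : ∀ k, φ 1 * y k = y k
  corner : ∀ b, ∃ a, φ 1 * b * φ 1 = φ a
  left_unit : ∀ b, ∀ᶠ s : Finset ι in atTop, (∑ k ∈ s, x k * y k) * b = b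
  right_unit : ∀ b, ∀ᶠ s : Finset ι in atTop, b * ∑ k ∈ s, x k * y k = b

namespace IsCornerFrame

section Bijective

variable {R B B' ι : Type*} [Ring R] [NonUnitalRing B] [NonUnitalRing B'] {φ : R →ₙ+* B}
  {φ' : R →ₙ+* B'} {x y : ι → B} {x' y' : ι → B'}

theorem exists_corner (h : IsCornerFrame φ x y) (k l : ι) (b : B) :
    ∃ a, y k * b * x l = φ a := by
  obtain ⟨a, ha⟩ := h.corner (y k * b * x l)
  refine ⟨a, ?_⟩
  simp only [← ha, mul_assoc, h.x_corner]
  rw [← mul_assoc (φ 1), h.corner_y]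

/-- Sandwich b between a local unit and itself. The coefficients y_k b x_l are the matrix entries of
b and lie in φ(R). -/
theorem eq_sum (h : IsCornerFrame φ x y) (b : B) :
    ∃ s : Finset ι, b = ∑ k ∈ s, ∑ l ∈ s, x k * (y k * b * x l) * y l := by
  obtain ⟨s, hl, hr⟩ := ((h.left_unit b).and (h.right_unit b)).exists
  refine ⟨s, ?_⟩
  conv_lhs => rw [← hl, ← hr]
  rw [Finset.sum_mul]
  refine Finset.sum_congr rfl fun k _ => ?_
  rw [Finset.mul_sum, Finset.mul_sum]
  refine Finset.sum_congr rfl fun l _ => ?_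
  simp only [mul_assoc]

/-- A homomorphism that matches two frames over the same unital ring is bijective as soon as the
second corner is a faithful copy of that ring. -/
theorem bijective (h : IsCornerFrame φ x y) (h' : IsCornerFrame φ' x' y') (ψ : B →ₙ+* B')
    (hφ : ∀ a, ψ (φ a) = φ' a) (hx : ∀ k, ψ (x k) = x' k) (hy : ∀ k, ψ (y k) = y' k)
    (hinj : Function.Injective φ') : Function.Bijective ψ := by
  constructor
  · rw [injective_iff_map_eq_zero]
    intro b hb
    obtain ⟨s, hs⟩ := h.eq_sum b
    rw [hs]
    refine Finset.sum_eq_zero fun k _ => Finset.sum_eq_zero fun l _ => ?_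
    obtain ⟨a, ha⟩ := h.exists_corner k l b
    -- The entry a of b is sent to y'_k ψ(b) x'_l = 0, so faithfulness of the second corner kills
    -- it.
    have : φ' a = φ' 0 := by rw [← hφ, ← ha, map_mul, map_mul, hb, map_zero]; simp
    rw [ha, hinj this, map_zero, mul_zero, zero_mul]
  · intro b
    obtain ⟨s, hs⟩ := h'.eq_sum b
    choose a ha using fun k l => h'.exists_corner k l b
    refine ⟨∑ k ∈ s, ∑ l ∈ s, x k * φ (a k l) * y l, ?_⟩
    simp only [map_sum, map_mul, hφ, hx, hy, ← ha]
    exact hs.symm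

end Bijective

end IsCornerFrame

/-! ### Unitary modules over a framed ring and the functor M ↦ φ(1)M. -/

namespace UnitaryModuleCat

variable {R : Type u} {B : Type v} [Ring R] [NonUnitalRing B]

theorem act_mul (M : UnitaryModuleCat.{v, w} B) (a b : B) (m : M.carrier) :
    M.act (a * b) m = M.act a (M.act b m) := by
  rw [map_mul]; rfl

/-- The corner `φ(1) M` of a unitary module. -/
def corner (φ : R →ₙ+* B) (M : UnitaryModuleCat.{v, w} B) : AddSubgroup M.carrier where
  carrier := {m | M.act (φ 1) m = m}
  zero_mem' := map_zero _
  add_mem' {a b} ha hb := by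
    change M.act (φ 1) (a + b) = a + b
    rw [map_add, ha, hb]
  neg_mem' {a} ha := by
    change M.act (φ 1) (-a) = -a
    rw [map_neg, ha]

theorem mem_corner {φ : R →ₙ+* B} {M : UnitaryModuleCat.{v, w} B} {m : M.carrier} :
    m ∈ corner φ M ↔ M.act (φ 1) m = m := Iff.rfl

theorem act_mem_corner {φ : R →ₙ+* B} {M : UnitaryModuleCat.{v, w} B} {b : B}
    (hb : φ 1 * b = b) (m : M.carrier) : M.act b m ∈ corner φ M := by
  rw [mem_corner, ← act_mul, hb]

instance (φ : R →ₙ+* B) (M : UnitaryModuleCat.{v, w} B) : Module R (corner φ M) where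
  smul a m := ⟨M.act (φ a) m.1, act_mem_corner (by rw [← map_mul, one_mul]) _⟩
  one_smul m := Subtype.ext m.2
  mul_smul a b m := Subtype.ext (by
    change M.act (φ (a * b)) m.1 = M.act (φ a) (M.act (φ b) m.1)
    rw [map_mul, act_mul])
  smul_zero a := Subtype.ext (map_zero _)
  smul_add a m n := Subtype.ext (map_add _ _ _)
  add_smul a b m := Subtype.ext (by
    change M.act (φ (a + b)) m.1 = M.act (φ a) m.1 + M.act (φ b) m.1
    rw [map_add, map_add]; rfl)
  zero_smul m := Subtype.ext (by
    change M.act (φ 0) m.1 = 0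
    rw [map_zero, map_zero]; rfl)

theorem coe_smul_corner {φ : R →ₙ+* B} {M : UnitaryModuleCat.{v, w} B} (a : R)
    (m : corner φ M) : ((a • m : corner φ M) : M.carrier) = M.act (φ a) m := rfl

/-- The functor that sends a unitary `B`-module `M` to the `R`-module `φ(1) M`. -/
def cornerFunctor (φ : R →ₙ+* B) : UnitaryModuleCat.{v, w} B ⥤ ModuleCat.{w} R where
  obj M := ModuleCat.of R (corner φ M)
  map {M N} f := ModuleCat.ofHom
    { toFun := fun m => ⟨f.toAddMonoidHom m.1, by
        rw [mem_corner, ← f.map_act, mem_corner.1 m.2]⟩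
      map_add' := fun m n => Subtype.ext (map_add _ _ _)
      map_smul' := fun a m => Subtype.ext (f.map_act _ _) }
  map_id _ := rfl
  map_comp _ _ := rfl

variable {ι : Type x} {φ : R →ₙ+* B} {x y : ι → B}

/-- Since M = BM, the local units of B also act as local units on M. "Eventually" rather than "for
some s" lets finitely many such conditions be met at once. -/
theorem eventually_unit (h : IsCornerFrame φ x y) (M : UnitaryModuleCat.{v, w} B)
    (m : M.carrier) : ∀ᶠ s : Finset ι in atTop, M.act (∑ k ∈ s, x k * y k) m = m := by
  have hm : m ∈ AddSubgroup.closure {m : M.carrier | ∃ (a : B) (n : M.carrier), m = M.act a n} := by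
    rw [M.unitary]; trivial
  induction hm using AddSubgroup.closure_induction with
  | mem m hm =>
    obtain ⟨a, n, rfl⟩ := hm
    filter_upwards [h.left_unit a] with s hs
    rw [← act_mul, hs]
  | zero => exact Eventually.of_forall fun s => map_zero _
  | add a b _ _ ha hb =>
    filter_upwards [ha, hb] with s hs hs'
    rw [map_add, hs, hs']
  | neg a _ ha =>
    filter_upwards [ha] with s hs
    rw [map_neg, hs]

theorem act_sum (M : UnitaryModuleCat.{v, w} B) {κ : Type*} (s : Finset κ) (f : κ → B)
    (m : M.carrier) : M.act (∑ k ∈ s, f k) m = ∑ k ∈ s, M.act (f k) m := by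
  rw [map_sum]; exact AddMonoidHom.finsetSum_apply _ _ _

/-- A homomorphism is determined on φ(1)M because m = ∑ x_k (y_k m) with every y_k m in the corner.
-/
theorem cornerFunctor_faithful (h : IsCornerFrame φ x y) :
    (cornerFunctor.{u, v, w} φ).Faithful where
  map_injective {M N f g} hfg := by
    refine Hom.ext (AddMonoidHom.ext fun m => ?_)
    obtain ⟨s, hs⟩ := (eventually_unit h M m).exists
    rw [← hs, act_sum, map_sum, map_sum]
    refine Finset.sum_congr rfl fun k _ => ?_
    rw [act_mul, f.map_act, g.map_act]
    congr 1
    have := congrArg (fun q => ((q.hom ⟨M.act (y k) m, act_mem_corner (h.corner_y k) m⟩ :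
      corner φ N) : N.carrier)) hfg
    exact this

section Extension

variable {M N : UnitaryModuleCat.{v, w} B}

/-- The partial sums of the extension to `M` of an `R`-linear map between the corners. -/
def extendPartial (h : IsCornerFrame φ x y) (g : corner φ M →ₗ[R] corner φ N) (s : Finset ι) :
    M.carrier →+ N.carrier :=
  ∑ k ∈ s, (N.act (x k)).comp ((corner φ N).subtype.comp (g.toAddMonoidHom.comp
    ((M.act (y k)).codRestrict (corner φ M) (act_mem_corner (h.corner_y k)))))

theorem extendPartial_apply (h : IsCornerFrame φ x y) (g : corner φ M →ₗ[R] corner φ N)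
    (s : Finset ι) (m : M.carrier) : extendPartial h g s m =
      ∑ k ∈ s, N.act (x k) (g ⟨M.act (y k) m, act_mem_corner (h.corner_y k) m⟩ : corner φ N) := by
  rw [extendPartial, AddMonoidHom.finsetSum_apply]
  rfl

/-- The three conditions on b say that b = φ(a) for some a, so this is R-linearity of g. -/
theorem map_act_corner (g : corner φ M →ₗ[R] corner φ N) {b : B} (hb : φ 1 * b * φ 1 ∈ Set.range φ)
    (hl : φ 1 * b = b) (hr : b * φ 1 = b) (m : corner φ M)
    (hm : M.act b m ∈ corner φ M) :
    (g ⟨M.act b m, hm⟩ : N.carrier) = N.act b (g m : corner φ N) := by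
  obtain ⟨a, ha⟩ := hb
  rw [hl, hr] at ha
  have : (⟨M.act b m, hm⟩ : corner φ M) = a • m := Subtype.ext (by
    rw [coe_smul_corner, ha])
  rw [this, map_smul, coe_smul_corner, ha]

/-- Each y_k b lies in φ(1)Bφ(1), so g commutes with it and the partial unit can be collected in
front. This is the computation behind both convergence and B-linearity of the extension. -/
theorem extendPartial_act_corner (h : IsCornerFrame φ x y) (g : corner φ M →ₗ[R] corner φ N)
    (s : Finset ι) {b : B} (hb : b * φ 1 = b) (m : corner φ M) :
    extendPartial h g s (M.act b m) = N.act ((∑ k ∈ s, x k * y k) * b) (g m : corner φ N) := by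
  rw [extendPartial_apply, Finset.sum_mul, act_sum]
  refine Finset.sum_congr rfl fun k _ => ?_
  rw [mul_assoc, act_mul]
  congr 1
  have hm : M.act (y k * b) m ∈ corner φ M :=
    act_mem_corner (by rw [← mul_assoc, h.corner_y]) _
  rw [← map_act_corner g (b := y k * b) ((h.corner _).imp fun _ h => h.symm)
    (by rw [← mul_assoc, h.corner_y]) (by rw [mul_assoc, hb]) m hm]
  congr 2
  exact Subtype.ext (act_mul _ _ _ _).symm

theorem extendPartial_act (h : IsCornerFrame φ x y) (g : corner φ M →ₗ[R] corner φ N)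
    (b : B) {s : Finset ι} {m : M.carrier} (hs : M.act (∑ k ∈ s, x k * y k) m = m) :
    ∀ᶠ s' in atTop, extendPartial h g s' (M.act b m) = N.act b (extendPartial h g s m) := by
  -- Write b m = ∑ (b x_l)(y_l m) over s. Only the finitely many elements b x_l must be fixed by the
  -- larger partial unit.
  filter_upwards [(Finset.eventually_all s).2 fun l _ => h.left_unit (b * x l)] with s' hs'
  conv_lhs => rw [← hs]
  rw [act_sum, map_sum, map_sum, extendPartial_apply, map_sum]
  refine Finset.sum_congr rfl fun l hl => ?_
  rw [← act_mul, ← mul_assoc, act_mul, ← act_mul N]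
  conv_rhs => rw [← hs' l hl]
  exact extendPartial_act_corner h g s' (by rw [mul_assoc, h.x_corner])
    ⟨_, act_mem_corner (h.corner_y l) m⟩

/-- The sums ∑ x_k g(y_k m) stabilise, which makes the extension of g well defined without a tensor
product. -/
theorem extendPartial_eventually (h : IsCornerFrame φ x y) (g : corner φ M →ₗ[R] corner φ N)
    {s : Finset ι} {m : M.carrier} (hs : M.act (∑ k ∈ s, x k * y k) m = m) :
    ∀ᶠ s' in atTop, extendPartial h g s' m = extendPartial h g s m := by
  filter_upwards [(Finset.eventually_all s).2 fun l _ => h.left_unit (x l)] with s' hs'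
  conv_lhs => rw [← hs]
  rw [act_sum, map_sum, extendPartial_apply h g s]
  refine Finset.sum_congr rfl fun l hl => ?_
  rw [act_mul]
  conv_rhs => rw [← hs' l hl]
  exact extendPartial_act_corner h g s' (h.x_corner l) ⟨_, act_mem_corner (h.corner_y l) m⟩

theorem exists_extend (h : IsCornerFrame φ x y) (g : corner φ M →ₗ[R] corner φ N)
    (m : M.carrier) : ∃ n, ∀ᶠ s in atTop, extendPartial h g s m = n := by
  obtain ⟨s, hs⟩ := (eventually_unit h M m).exists
  exact ⟨_, extendPartial_eventually h g hs⟩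

/-- The extension to `M` of an `R`-linear map between the corners. -/
noncomputable def extend (h : IsCornerFrame φ x y) (g : corner φ M →ₗ[R] corner φ N) : M ⟶ N where
  toAddMonoidHom :=
    { toFun := fun m => (exists_extend h g m).choose
      map_zero' := by
        obtain ⟨s, hs⟩ := (exists_extend h g 0).choose_spec.exists
        rw [← hs, map_zero]
      map_add' := fun m n => by
        obtain ⟨s, h1, h2, h3⟩ := ((exists_extend h g (m + n)).choose_spec.and
          ((exists_extend h g m).choose_spec.and (exists_extend h g n).choose_spec)).exists
        rw [← h1, ← h2, ← h3, map_add] }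
  map_act b m := by
    obtain ⟨s, h1, h2⟩ := ((exists_extend h g m).choose_spec.and (eventually_unit h M m)).exists
    obtain ⟨s', h3, h4⟩ := ((exists_extend h g (M.act b m)).choose_spec.and
      (extendPartial_act h g b h2)).exists
    exact h3.symm.trans (h4.trans (congrArg (N.act b) h1))

theorem extend_apply (h : IsCornerFrame φ x y) (g : corner φ M →ₗ[R] corner φ N)
    (m : M.carrier) :
    ∀ᶠ s in atTop, extendPartial h g s m = (extend h g).toAddMonoidHom m :=
  (exists_extend h g m).choose_spec

theorem extend_corner (h : IsCornerFrame φ x y) (g : corner φ M →ₗ[R] corner φ N)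
    (m : corner φ M) : (extend h g).toAddMonoidHom m.1 = g m := by
  have hφ : φ 1 * φ 1 = φ 1 := by rw [← map_mul, one_mul]
  -- A partial unit fixing φ(1) suffices: m = φ(1)m, so the computation on the corner applies with b
  -- = φ(1).
  obtain ⟨s, h1, h2⟩ := ((extend_apply h g m.1).and (h.left_unit (φ 1))).exists
  rw [← h1]
  conv_lhs => rw [← mem_corner.1 m.2]
  rw [extendPartial_act_corner h g s hφ m, h2]
  exact mem_corner.1 (g m).2

end Extension

theorem cornerFunctor_full (h : IsCornerFrame φ x y) : (cornerFunctor.{u, v, w} φ).Full where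
  map_surjective {M N} f := ⟨extend h f.hom, by
    ext m
    exact Subtype.ext (extend_corner h f.hom m)⟩

section Unitarize

variable {P : Type w} [AddCommGroup P]

/-- The subgroup `B P` of a not necessarily unitary `B`-module `P`. -/
def unitaryPart (act : B →ₙ+* AddMonoid.End P) : AddSubgroup P :=
  AddSubgroup.closure {m | ∃ b n, m = act b n}

theorem act_mem_unitaryPart (act : B →ₙ+* AddMonoid.End P) (b : B) (p : P) :
    act b p ∈ unitaryPart act :=
  AddSubgroup.subset_closure ⟨b, p, rfl⟩

/-- The unitary module `B P`, where `P` is a not necessarily unitary `B`-module. -/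
def unitarize (h : IsCornerFrame φ x y) (act : B →ₙ+* AddMonoid.End P) :
    UnitaryModuleCat.{v, w} B where
  carrier := unitaryPart act
  act :=
    { toFun := fun b => ((act b).comp (unitaryPart act).subtype).codRestrict _
        fun _ => act_mem_unitaryPart _ _ _
      map_mul' := fun a b => AddMonoidHom.ext fun p => Subtype.ext (by
        change act (a * b) p.1 = act a (act b p.1)
        rw [map_mul]; rfl)
      map_zero' := AddMonoidHom.ext fun p => Subtype.ext (by
        change act 0 p.1 = 0
        rw [map_zero]; rfl)
      map_add' := fun a b => AddMonoidHom.ext fun p => Subtype.ext (by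
        change act (a + b) p.1 = act a p.1 + act b p.1
        rw [map_add]; rfl) }
  unitary := by
    rw [eq_top_iff]
    rintro ⟨p, hp⟩ -
    change p ∈ AddSubgroup.closure _ at hp
    induction hp using AddSubgroup.closure_induction with
    | mem p hp =>
      obtain ⟨b, n, rfl⟩ := hp
      -- A local unit u with u b = b gives b n = u (b n), which exhibits b n as B acting on an
      -- element of BP rather than merely of P.
      obtain ⟨s, hs⟩ := (h.left_unit b).exists
      refine AddSubgroup.subset_closure
        ⟨∑ k ∈ s, x k * y k, ⟨act b n, act_mem_unitaryPart _ _ _⟩, Subtype.ext ?_⟩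
      change act b n = act _ (act b n)
      conv_lhs => rw [← hs, map_mul]
      rfl
    | zero => exact zero_mem _
    | add a b ha hb ha' hb' => exact add_mem ha' hb'
    | neg a ha ha' => exact neg_mem ha'

end Unitarize

/-- P may be too large to be unitary. Passing to BP does not change the corner, since φ(1)P ⊆ BP. -/
theorem cornerFunctor_essSurj (h : IsCornerFrame φ x y)
    (hN : ∀ N : ModuleCat.{w} R, ∃ (P : Type w) (_ : AddCommGroup P)
      (act : B →ₙ+* AddMonoid.End P) (j : N →+ P), Function.Injective j ∧
      (∀ (a : R) (n : N), j (a • n) = act (φ a) (j n)) ∧ ∀ p, act (φ 1) p ∈ Set.range j) :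
    (cornerFunctor.{u, v, w} φ).EssSurj where
  mem_essImage N := by
    obtain ⟨P, _, act, j, hj, hact, hrange⟩ := hN N
    have h1 (n : N) : act (φ 1) (j n) = j n := by rw [← hact, one_smul]
    let e : N →ₗ[R] corner φ (unitarize h act) :=
      { toFun := fun n => ⟨⟨j n, h1 n ▸ act_mem_unitaryPart act _ _⟩, Subtype.ext (h1 n)⟩
        map_add' := fun m n => Subtype.ext (Subtype.ext (map_add _ _ _))
        map_smul' := fun a n => Subtype.ext (Subtype.ext (hact a n)) }
    have he : Function.Bijective e := by
      constructor
      · intro m n hmn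
        exact hj (congrArg (fun q => q.1.1) hmn)
      · rintro ⟨⟨p, hp⟩, hp'⟩
        obtain ⟨n, hn⟩ := hrange p
        refine ⟨n, Subtype.ext (Subtype.ext (hn.trans ?_))⟩
        exact congrArg Subtype.val hp'
    exact ⟨unitarize h act, ⟨(LinearEquiv.ofBijective e he).toModuleIso.symm⟩⟩

end UnitaryModuleCat

/-! ### Vanishing products of generators, and span criteria for corners. -/

namespace IsCuntzKriegerFamily

variable {V : Type v} {Ed : Type w} {E : DirectedGraph V Ed} {A : Type x} [NonUnitalRing A]
  {f : LeavittGen V Ed → A}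

theorem vert_mul_edge_ne (hf : IsCuntzKriegerFamily E f) {a : V} {e : Ed} (h : a ≠ E.s e) :
    f (vert a) * f (edge e) = 0 := by
  rw [← hf.source_edge, ← mul_assoc, hf.vert_orth _ _ h, zero_mul]

theorem edge_mul_vert_ne (hf : IsCuntzKriegerFamily E f) {a : V} {e : Ed} (h : E.r e ≠ a) :
    f (edge e) * f (vert a) = 0 := by
  rw [← hf.edge_range, mul_assoc, hf.vert_orth _ _ h, mul_zero]

theorem vert_mul_ghost_ne (hf : IsCuntzKriegerFamily E f) {a : V} {e : Ed} (h : a ≠ E.r e) :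
    f (vert a) * f (ghost e) = 0 := by
  rw [← hf.range_ghost, ← mul_assoc, hf.vert_orth _ _ h, zero_mul]

theorem ghost_mul_vert_ne (hf : IsCuntzKriegerFamily E f) {a : V} {e : Ed} (h : E.s e ≠ a) :
    f (ghost e) * f (vert a) = 0 := by
  rw [← hf.ghost_source, mul_assoc, hf.vert_orth _ _ h, mul_zero]

theorem ghost_mul_ghost_ne (hf : IsCuntzKriegerFamily E f) {e e' : Ed} (h : E.s e ≠ E.r e') :
    f (ghost e) * f (ghost e') = 0 := by
  rw [← hf.range_ghost e', ← mul_assoc, hf.ghost_mul_vert_ne h, zero_mul]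

end IsCuntzKriegerFamily

namespace LeavittPathAlgebra

section Corner

variable {K : Type u} [Field K] {V : Type v} {Ed : Type w} {E : DirectedGraph V Ed}
  {R : Type*} [Ring R] [Module K R] {ι : Type*} {φ : R →ₙₐ[K] LeavittPathAlgebra K E}
  {x y : ι → LeavittPathAlgebra K E}

/-- Right multiplication by a generator keeps the set of all φ(a) y_l, up to zero; induction on
words extends this to all of the algebra. -/
theorem mul_mem_span (hy : ∀ k g, y k * gen K E g = 0 ∨ ∃ a l, y k * gen K E g = φ a * y l)
    (k : ι) (b : LeavittPathAlgebra K E) :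
    y k * b ∈ Submodule.span K {z | ∃ a l, z = φ a * y l} := by
  have hφ (a : R) {z} (hz : z ∈ Submodule.span K {z | ∃ a l, z = φ a * y l}) :
      φ a * z ∈ Submodule.span K {z | ∃ a l, z = φ a * y l} := by
    induction hz using Submodule.span_induction with
    | mem z hz =>
      obtain ⟨a', l, rfl⟩ := hz
      exact Submodule.subset_span ⟨a * a', l, by rw [map_mul, mul_assoc]⟩
    | zero => rw [mul_zero]; exact zero_mem _
    | add p q _ _ hp hq => rw [mul_add]; exact add_mem hp hq
    | smul c p _ hp => rw [mul_smul_comm]; exact Submodule.smul_mem _ _ hp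
  induction b using LeavittPathAlgebra.induction generalizing k with
  | zero => rw [mul_zero]; exact zero_mem _
  | add p q hp hq => rw [mul_add]; exact add_mem (hp k) (hq k)
  | smul c p hp => rw [mul_smul_comm]; exact Submodule.smul_mem _ _ (hp k)
  | gen g =>
    obtain h | ⟨a, l, h⟩ := hy k g
    · rw [h]; exact zero_mem _
    · rw [h]; exact Submodule.subset_span ⟨a, l, rfl⟩
  | gen_mul g b hb =>
    rw [← mul_assoc]
    obtain h | ⟨a, l, h⟩ := hy k g
    · rw [h, zero_mul]; exact zero_mem _
    · rw [h, mul_assoc]; exact hφ a (hb l)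

theorem mem_span_mul (hx : ∀ g k, gen K E g * x k = 0 ∨ ∃ a l, gen K E g * x k = x l * φ a)
    (b : LeavittPathAlgebra K E) (k : ι) :
    b * x k ∈ Submodule.span K {z | ∃ a l, z = x l * φ a} := by
  have hg (g) {z} (hz : z ∈ Submodule.span K {z | ∃ a l, z = x l * φ a}) :
      gen K E g * z ∈ Submodule.span K {z | ∃ a l, z = x l * φ a} := by
    induction hz using Submodule.span_induction with
    | mem z hz =>
      obtain ⟨a', l, rfl⟩ := hz
      rw [← mul_assoc]
      obtain h | ⟨a, l, h⟩ := hx g l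
      · rw [h, zero_mul]; exact zero_mem _
      · exact Submodule.subset_span ⟨a * a', l, by rw [h, map_mul, mul_assoc]⟩
    | zero => rw [mul_zero]; exact zero_mem _
    | add p q _ _ hp hq => rw [mul_add]; exact add_mem hp hq
    | smul c p _ hp => rw [mul_smul_comm]; exact Submodule.smul_mem _ _ hp
  induction b using LeavittPathAlgebra.induction with
  | zero => rw [zero_mul]; exact zero_mem _
  | add p q hp hq => rw [add_mul]; exact add_mem hp hq
  | smul c p hp => rw [smul_mul_assoc]; exact Submodule.smul_mem _ _ hp
  | gen g =>
    obtain h | ⟨a, l, h⟩ := hx g k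
    · rw [h]; exact zero_mem _
    · rw [h]; exact Submodule.subset_span ⟨a, l, rfl⟩
  | gen_mul g b hb => rw [mul_assoc]; exact hg g hb

/-- As φ(1) is itself one of the y_k, φ(1)b is a combination of terms φ(a) y_l, and multiplying
these on the right by φ(1) lands in the image of φ. -/
theorem exists_corner_eq (hy : ∀ k g, y k * gen K E g = 0 ∨ ∃ a l, y k * gen K E g = φ a * y l)
    (hy2 : ∀ k, ∃ a, y k * φ 1 = φ a) {k₀ : ι} (hk₀ : y k₀ = φ 1)
    (b : LeavittPathAlgebra K E) : ∃ a, φ 1 * b * φ 1 = φ a := by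
  have h := mul_mem_span hy k₀ b
  rw [hk₀] at h
  generalize φ 1 * b = z at h
  induction h using Submodule.span_induction with
  | mem z hz =>
    obtain ⟨a, l, rfl⟩ := hz
    obtain ⟨a', ha'⟩ := hy2 l
    exact ⟨a * a', by rw [mul_assoc, ha', map_mul]⟩
  | zero => exact ⟨0, by rw [zero_mul, map_zero]⟩
  | add p q _ _ hp hq =>
    obtain ⟨a, ha⟩ := hp
    obtain ⟨b, hb⟩ := hq
    exact ⟨a + b, by rw [add_mul, ha, hb, map_add]⟩
  | smul c p _ hp =>
    obtain ⟨a, ha⟩ := hp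
    exact ⟨c • a, by rw [smul_mul_assoc, ha, map_smul]⟩

end Corner

section MapOne

variable {K : Type u} [Field K] {V : Type v} {Ed : Type w} [Finite V] {E : DirectedGraph V Ed}
  {B : Type*} [NonUnitalRing B] [Module K B]

theorem map_one_mul_map (φ : LeavittPathAlgebra K E →ₙₐ[K] B) (a : LeavittPathAlgebra K E) :
    φ 1 * φ a = φ a := by rw [← map_mul, one_mul]

theorem map_mul_map_one (φ : LeavittPathAlgebra K E →ₙₐ[K] B) (a : LeavittPathAlgebra K E) :
    φ a * φ 1 = φ a := by rw [← map_mul, mul_one]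

theorem map_one_mul_eq_zero (φ : LeavittPathAlgebra K E →ₙₐ[K] B) {z : B}
    (h : ∀ a, φ (ofVert K E a) * z = 0) : φ 1 * z = 0 := by
  rw [one_def, vertexSum, map_sum, Finset.sum_mul]
  exact Finset.sum_eq_zero fun a _ => h a

theorem mul_map_one_eq_zero (φ : LeavittPathAlgebra K E →ₙₐ[K] B) {z : B}
    (h : ∀ a, z * φ (ofVert K E a) = 0) : z * φ 1 = 0 := by
  rw [one_def, vertexSum, map_sum, Finset.mul_sum]
  exact Finset.sum_eq_zero fun a _ => h a

end MapOne

end LeavittPathAlgebra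

/-! ### Hedgehog graphs and the frame of their Leavitt path algebras. -/

namespace DirectedGraph

/-- The graph obtained from `G` by attaching, for each `k : ι`, a new vertex that emits a single
edge, with range `r k`. -/
def hedgehog {W : Type v} {D : Type w} {ι : Type x} (G : DirectedGraph W D) (r : ι → W) :
    DirectedGraph (W ⊕ ι) (D ⊕ ι) where
  s := Sum.map G.s id
  r := Sum.elim (fun d => Sum.inl (G.r d)) (fun k => Sum.inl (r k))

variable {W : Type v} {D : Type w} {ι : Type x} (G : DirectedGraph W D) (r : ι → W)

theorem hedgehog_s_preimage_inl (a : W) :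
    (G.hedgehog r).s ⁻¹' {Sum.inl a} = Sum.inl '' (G.s ⁻¹' {a}) := by
  ext (d | k) <;> simp [hedgehog]

theorem hedgehog_s_preimage_inr (k : ι) :
    (G.hedgehog r).s ⁻¹' {Sum.inr k} = {Sum.inr k} := by
  ext (d | k) <;> simp [hedgehog]

end DirectedGraph

namespace LeavittPathAlgebra

section Hedgehog

variable (K : Type u) [Field K] {W : Type v} {D : Type w} {ι : Type x} (G : DirectedGraph W D)
  (r : ι → W)

/-- The inclusion of the generating symbols of `G` into those of a hedgehog graph on `G`. -/
def hedgehogGen (ι : Type x) : LeavittGen W D → LeavittGen (W ⊕ ι) (D ⊕ ι)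
  | vert a => vert (Sum.inl a)
  | edge e => edge (Sum.inl e)
  | ghost e => ghost (Sum.inl e)

theorem isCuntzKriegerFamily_hedgehogGen :
    IsCuntzKriegerFamily G (fun g => gen K (G.hedgehog r) (hedgehogGen ι g)) where
  vert_idem a := (isCuntzKriegerFamily_gen K (G.hedgehog r)).vert_idem _
  vert_orth a b h := (isCuntzKriegerFamily_gen K (G.hedgehog r)).vert_orth _ _ (by simpa using h)
  source_edge e := (isCuntzKriegerFamily_gen K (G.hedgehog r)).source_edge (Sum.inl e)
  edge_range e := (isCuntzKriegerFamily_gen K (G.hedgehog r)).edge_range (Sum.inl e)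
  range_ghost e := (isCuntzKriegerFamily_gen K (G.hedgehog r)).range_ghost (Sum.inl e)
  ghost_source e := (isCuntzKriegerFamily_gen K (G.hedgehog r)).ghost_source (Sum.inl e)
  ghost_edge_self e := (isCuntzKriegerFamily_gen K (G.hedgehog r)).ghost_edge_self (Sum.inl e)
  ghost_edge_ne e e' h :=
    (isCuntzKriegerFamily_gen K (G.hedgehog r)).ghost_edge_ne _ _ (by simpa using h)
  regular_vert a hfin hne := by
    classical
    have h := G.hedgehog_s_preimage_inl r a
    have hfin' : ((G.hedgehog r).s ⁻¹' {Sum.inl a}).Finite := h ▸ hfin.image _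
    refine ((isCuntzKriegerFamily_gen K (G.hedgehog r)).regular_vert (Sum.inl a) hfin'
      (h ▸ hne.image _)).trans ?_
    have : hfin'.toFinset = hfin.toFinset.map ⟨Sum.inl, Sum.inl_injective⟩ := by
      ext; simp [h]
    rw [this, Finset.sum_map]
    rfl

/-- The canonical homomorphism from `L_K(G)` to the Leavitt path algebra of a hedgehog graph. -/
noncomputable def hedgehogHom :
    LeavittPathAlgebra K G →ₙₐ[K] LeavittPathAlgebra K (G.hedgehog r) :=
  lift K _ (isCuntzKriegerFamily_hedgehogGen K G r)

theorem hedgehogHom_gen (g : LeavittGen W D) :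
    hedgehogHom K G r (gen K G g) = gen K (G.hedgehog r) (hedgehogGen ι g) :=
  lift_gen K _ _ g

/-- A new vertex emits exactly one edge, so its Cuntz-Krieger relation has a single summand. -/
theorem hedgehog_edge_mul_ghost (k : ι) :
    gen K (G.hedgehog r) (edge (Sum.inr k)) * gen K (G.hedgehog r) (ghost (Sum.inr k))
      = gen K (G.hedgehog r) (vert (Sum.inr k)) := by
  have h := G.hedgehog_s_preimage_inr r k
  have hfin : ((G.hedgehog r).s ⁻¹' {Sum.inr k}).Finite := h ▸ Set.finite_singleton _
  rw [(isCuntzKriegerFamily_gen K (G.hedgehog r)).regular_vert _ hfin (h ▸ Set.singleton_nonempty _)]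
  have : hfin.toFinset = {Sum.inr k} := by ext; simp [h]
  rw [this, Finset.sum_singleton]

/-- The elements of `L_K(E)` for a hedgehog graph `E` given by the added edges and by the identity
of `L_K(G)`. -/
noncomputable def hedgehogLeft [Finite W] : Option ι → LeavittPathAlgebra K (G.hedgehog r)
  | none => hedgehogHom K G r 1
  | some k => gen K (G.hedgehog r) (edge (Sum.inr k))

/-- The elements of `L_K(E)` for a hedgehog graph `E` given by the added ghost edges and by the
identity of `L_K(G)`. -/
noncomputable def hedgehogRight [Finite W] : Option ι → LeavittPathAlgebra K (G.hedgehog r)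
  | none => hedgehogHom K G r 1
  | some k => gen K (G.hedgehog r) (ghost (Sum.inr k))

variable [Finite W]

theorem hedgehogHom_one_mul_gen (g : LeavittGen W D) :
    hedgehogHom K G r 1 * gen K (G.hedgehog r) (hedgehogGen ι g)
      = gen K (G.hedgehog r) (hedgehogGen ι g) := by
  rw [← hedgehogHom_gen, map_one_mul_map]

theorem gen_mul_hedgehogHom_one (g : LeavittGen W D) :
    gen K (G.hedgehog r) (hedgehogGen ι g) * hedgehogHom K G r 1
      = gen K (G.hedgehog r) (hedgehogGen ι g) := by
  rw [← hedgehogHom_gen, map_mul_map_one]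

theorem hedgehogHom_one_mul_inr (k : ι) :
    hedgehogHom K G r 1 * gen K (G.hedgehog r) (vert (Sum.inr k)) = 0 :=
  map_one_mul_eq_zero _ fun a => by
    rw [ofVert, hedgehogHom_gen]
    exact (isCuntzKriegerFamily_gen K (G.hedgehog r)).vert_orth _ _ (by simp)

theorem inr_mul_hedgehogHom_one (k : ι) :
    gen K (G.hedgehog r) (vert (Sum.inr k)) * hedgehogHom K G r 1 = 0 :=
  mul_map_one_eq_zero _ fun a => by
    rw [ofVert, hedgehogHom_gen]
    exact (isCuntzKriegerFamily_gen K (G.hedgehog r)).vert_orth _ _ (by simp)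

theorem hedgehogHom_one_mul_ghost_inr (k : ι) :
    hedgehogHom K G r 1 * gen K (G.hedgehog r) (ghost (Sum.inr k))
      = gen K (G.hedgehog r) (ghost (Sum.inr k)) := by
  rw [← (isCuntzKriegerFamily_gen K (G.hedgehog r)).range_ghost, ← mul_assoc]
  congr 1
  exact hedgehogHom_one_mul_gen K G r (vert (r k))

theorem edge_inr_mul_hedgehogHom_one (k : ι) :
    gen K (G.hedgehog r) (edge (Sum.inr k)) * hedgehogHom K G r 1
      = gen K (G.hedgehog r) (edge (Sum.inr k)) := by
  rw [← (isCuntzKriegerFamily_gen K (G.hedgehog r)).edge_range, mul_assoc]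
  congr 1
  exact gen_mul_hedgehogHom_one K G r (vert (r k))

theorem ghost_inr_mul_hedgehogHom_one (k : ι) :
    gen K (G.hedgehog r) (ghost (Sum.inr k)) * hedgehogHom K G r 1 = 0 := by
  rw [← (isCuntzKriegerFamily_gen K (G.hedgehog r)).ghost_source, mul_assoc]
  change _ * (gen K (G.hedgehog r) (vert (Sum.inr k)) * _) = 0
  rw [inr_mul_hedgehogHom_one, mul_zero]

theorem hedgehogHom_one_mul_edge_inr (k : ι) :
    hedgehogHom K G r 1 * gen K (G.hedgehog r) (edge (Sum.inr k)) = 0 := by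
  rw [← (isCuntzKriegerFamily_gen K (G.hedgehog r)).source_edge, ← mul_assoc]
  change _ * gen K (G.hedgehog r) (vert (Sum.inr k)) * _ = 0
  rw [hedgehogHom_one_mul_inr, zero_mul]

/-- New vertices receive no edges, so after a new ghost edge only its own vertex and its own edge
give a nonzero product. -/
theorem hedgehogRight_mul_gen (k : Option ι) (g : LeavittGen (W ⊕ ι) (D ⊕ ι)) :
    hedgehogRight K G r k * gen K (G.hedgehog r) g = 0 ∨
      ∃ a l, hedgehogRight K G r k * gen K (G.hedgehog r) g
        = hedgehogHom K G r a * hedgehogRight K G r l := by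
  have ck := isCuntzKriegerFamily_gen K (G.hedgehog r)
  have inl (g : LeavittGen W D) : ∃ a l, hedgehogRight K G r none *
      gen K (G.hedgehog r) (hedgehogGen ι g) = hedgehogHom K G r a * hedgehogRight K G r l :=
    ⟨gen K G g, none, by
      rw [hedgehogRight, hedgehogHom_one_mul_gen, map_mul_map_one, hedgehogHom_gen]⟩
  cases k with
  | none =>
    rcases g with (a | k) | (e | k) | (e | k)
    · exact .inr (inl (vert a))
    · exact .inl (hedgehogHom_one_mul_inr K G r k)
    · exact .inr (inl (edge e))
    · exact .inl (hedgehogHom_one_mul_edge_inr K G r k)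
    · exact .inr (inl (ghost e))
    · refine .inr ⟨1, some k, ?_⟩
      rfl
  | some k =>
    rcases g with (a | l) | (e | l) | (e | l)
    · exact .inl (ck.ghost_mul_vert_ne (by simp [DirectedGraph.hedgehog]))
    · by_cases h : k = l
      · subst h
        refine .inr ⟨1, some k, ?_⟩
        rw [hedgehogRight, hedgehogHom_one_mul_ghost_inr]
        exact ck.ghost_source (Sum.inr k)
      · exact .inl (ck.ghost_mul_vert_ne (by simpa [DirectedGraph.hedgehog] using h))
    · exact .inl (ck.ghost_edge_ne _ _ (by simp))
    · by_cases h : k = l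
      · subst h
        refine .inr ⟨gen K G (vert (r k)), none, ?_⟩
        rw [hedgehogRight, hedgehogRight, map_mul_map_one, hedgehogHom_gen]
        exact ck.ghost_edge_self (Sum.inr k)
      · exact .inl (ck.ghost_edge_ne _ _ (by simpa using h))
    · exact .inl (ck.ghost_mul_ghost_ne (by simp [DirectedGraph.hedgehog]))
    · exact .inl (ck.ghost_mul_ghost_ne (by simp [DirectedGraph.hedgehog]))

/-- The summand at `none` is the sum of the vertices of G and the one at `some k` is the k-th new
vertex, so these partial sums are sums of distinct vertices. -/
theorem hedgehog_sum_mul_vert (a : W ⊕ ι) :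
    ∀ᶠ s : Finset (Option ι) in atTop,
      (∑ k ∈ s, hedgehogLeft K G r k * hedgehogRight K G r k) * gen K (G.hedgehog r) (vert a)
        = gen K (G.hedgehog r) (vert a) ∧
      gen K (G.hedgehog r) (vert a) * (∑ k ∈ s, hedgehogLeft K G r k * hedgehogRight K G r k)
        = gen K (G.hedgehog r) (vert a) := by
  have ck := isCuntzKriegerFamily_gen K (G.hedgehog r)
  have h0 : hedgehogLeft K G r none * hedgehogRight K G r none = hedgehogHom K G r 1 :=
    map_one_mul_map _ _
  have h1 (k) : hedgehogLeft K G r (some k) * hedgehogRight K G r (some k)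
      = gen K (G.hedgehog r) (vert (Sum.inr k)) := hedgehog_edge_mul_ghost K G r k
  rcases a with a | l
  · filter_upwards [eventually_ge_atTop {none}] with s hs
    rw [Finset.singleton_subset_iff] at hs
    rw [Finset.sum_mul, Finset.mul_sum, Finset.sum_eq_single_of_mem none hs,
      Finset.sum_eq_single_of_mem none hs, h0]
    · exact ⟨hedgehogHom_one_mul_gen K G r (vert a), gen_mul_hedgehogHom_one K G r (vert a)⟩
    · rintro (_ | k) - hk
      · exact absurd rfl hk
      · rw [h1]; exact ck.vert_orth _ _ (by simp)
    · rintro (_ | k) - hk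
      · exact absurd rfl hk
      · rw [h1]; exact ck.vert_orth _ _ (by simp)
  · filter_upwards [eventually_ge_atTop {some l}] with s hs
    rw [Finset.singleton_subset_iff] at hs
    rw [Finset.sum_mul, Finset.mul_sum, Finset.sum_eq_single_of_mem _ hs,
      Finset.sum_eq_single_of_mem _ hs, h1]
    · exact ⟨ck.vert_idem _, ck.vert_idem _⟩
    · rintro (_ | k) - hk
      · rw [h0]; exact inr_mul_hedgehogHom_one K G r l
      · rw [h1]; exact ck.vert_orth _ _ (by simpa [eq_comm] using hk)
    · rintro (_ | k) - hk
      · rw [h0]; exact hedgehogHom_one_mul_inr K G r l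
      · rw [h1]; exact ck.vert_orth _ _ (by simpa using hk)

theorem hedgehog_isCornerFrame :
    IsCornerFrame (hedgehogHom K G r : LeavittPathAlgebra K G →ₙ+* _)
      (hedgehogLeft K G r) (hedgehogRight K G r) where
  x_corner := by
    rintro (_ | k)
    · exact map_one_mul_map _ _
    · exact edge_inr_mul_hedgehogHom_one K G r k
  corner_y := by
    rintro (_ | k)
    · exact map_one_mul_map _ _
    · exact hedgehogHom_one_mul_ghost_inr K G r k
  corner := by
    refine exists_corner_eq (φ := hedgehogHom K G r) (y := hedgehogRight K G r)
      (hedgehogRight_mul_gen K G r) ?_ (k₀ := none) rfl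
    · rintro (_ | k)
      · exact ⟨1, map_one_mul_map _ _⟩
      · exact ⟨0, by rw [map_zero]; exact ghost_inr_mul_hedgehogHom_one K G r k⟩
  left_unit b := by
    have hgen (g) : ∀ᶠ s : Finset (Option ι) in atTop,
        (∑ k ∈ s, hedgehogLeft K G r k * hedgehogRight K G r k) * gen K (G.hedgehog r) g
          = gen K (G.hedgehog r) g := by
      obtain ⟨a, ha⟩ := exists_ofVert_mul_gen K (G.hedgehog r) g
      filter_upwards [hedgehog_sum_mul_vert K G r a] with s hs
      rw [← ha, ← mul_assoc, ofVert, hs.1]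
    induction b using LeavittPathAlgebra.induction with
    | zero => exact Eventually.of_forall fun s => mul_zero _
    | add p q hp hq =>
      filter_upwards [hp, hq] with s hs hs'
      rw [mul_add, hs, hs']
    | smul c p hp =>
      filter_upwards [hp] with s hs
      rw [mul_smul_comm, hs]
    | gen g => exact hgen g
    | gen_mul g b _ =>
      filter_upwards [hgen g] with s hs
      rw [← mul_assoc, hs]
  right_unit b := by
    induction b using LeavittPathAlgebra.induction with
    | zero => exact Eventually.of_forall fun s => zero_mul _
    | add p q hp hq =>
      filter_upwards [hp, hq] with s hs hs'
      rw [add_mul, hs, hs']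
    | smul c p hp =>
      filter_upwards [hp] with s hs
      rw [smul_mul_assoc, hs]
    | gen g =>
      obtain ⟨a, ha⟩ := exists_gen_mul_ofVert K (G.hedgehog r) g
      filter_upwards [hedgehog_sum_mul_vert K G r a] with s hs
      rw [← ha, mul_assoc, ofVert, hs.2]
    | gen_mul g b hb =>
      filter_upwards [hb] with s hs
      rw [mul_assoc, hs]

end Hedgehog

end LeavittPathAlgebra

/-! ### The frame of I given by the paths leaving a source loop. -/

namespace DirectedGraph

variable {V : Type v} {Ed : Type w}

/-- The exits of a loop `τ`: the other edges with the same source. -/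
abbrev Exit (E : DirectedGraph V Ed) (τ : Ed) : Type w := {e : Ed // E.s e = E.s τ ∧ e ≠ τ}

theorem IsSourceLoop.range_exit_mem {E : DirectedGraph V Ed} {τ : Ed} (hτ : E.IsSourceLoop τ)
    (f : E.Exit τ) : E.r f.1 ∈ ({E.s τ}ᶜ : Set V) :=
  fun h => f.2.2 (hτ.2 _ h)

end DirectedGraph

namespace LeavittPathAlgebra

section SourceLoop

variable (K : Type u) [Field K] {V : Type v} {Ed : Type w} {E : DirectedGraph V Ed}
  {τ : Ed} (hτ : E.IsSourceLoop τ)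

theorem restrictHom_gen {H : Set V} (hH : E.Hereditary H)
    (g : LeavittGen H {e : Ed // E.s e ∈ H}) :
    restrictHom K hH (gen K _ g) = gen K E (restrictGen g) :=
  lift_gen K _ _ g

/-- The path `τ ^ n f`, where `f` is an exit of `τ`. -/
noncomputable def exitPath (f : E.Exit τ) : ℕ → LeavittPathAlgebra K E
  | 0 => gen K E (edge f.1)
  | n + 1 => gen K E (edge τ) * exitPath f n

/-- The ghost path `f* (τ*) ^ n`, where `f` is an exit of `τ`. -/
noncomputable def exitGhost (f : E.Exit τ) : ℕ → LeavittPathAlgebra K E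
  | 0 => gen K E (ghost f.1)
  | n + 1 => exitGhost f n * gen K E (ghost τ)

theorem source_mul_exitPath (f : E.Exit τ) (n : ℕ) :
    gen K E (vert (E.s τ)) * exitPath K f n = exitPath K f n := by
  cases n with
  | zero =>
    rw [← f.2.1]
    exact (isCuntzKriegerFamily_gen K E).source_edge _
  | succ n => rw [exitPath, ← mul_assoc, (isCuntzKriegerFamily_gen K E).source_edge]

theorem exitGhost_mul_source (f : E.Exit τ) (n : ℕ) :
    exitGhost K f n * gen K E (vert (E.s τ)) = exitGhost K f n := by
  cases n with
  | zero =>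
    rw [← f.2.1]
    exact (isCuntzKriegerFamily_gen K E).ghost_source _
  | succ n => rw [exitGhost, mul_assoc, (isCuntzKriegerFamily_gen K E).ghost_source]

theorem exitPath_mul_range (f : E.Exit τ) (n : ℕ) :
    exitPath K f n * gen K E (vert (E.r f.1)) = exitPath K f n := by
  induction n with
  | zero => exact (isCuntzKriegerFamily_gen K E).edge_range _
  | succ n ih => rw [exitPath, mul_assoc, ih]

theorem range_mul_exitGhost (f : E.Exit τ) (n : ℕ) :
    gen K E (vert (E.r f.1)) * exitGhost K f n = exitGhost K f n := by
  induction n with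
  | zero => exact (isCuntzKriegerFamily_gen K E).range_ghost _
  | succ n ih => rw [exitGhost, ← mul_assoc, ih]

variable {K} in
theorem mul_exitPath_eq_zero {z : LeavittPathAlgebra K E} (hz : z * gen K E (vert (E.s τ)) = 0)
    (f : E.Exit τ) (n : ℕ) : z * exitPath K f n = 0 := by
  rw [← source_mul_exitPath, ← mul_assoc, hz, zero_mul]

variable {K} in
theorem exitGhost_mul_eq_zero {z : LeavittPathAlgebra K E} (hz : gen K E (vert (E.s τ)) * z = 0)
    (f : E.Exit τ) (n : ℕ) : exitGhost K f n * z = 0 := by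
  rw [← exitGhost_mul_source, mul_assoc, hz, mul_zero]

include hτ in
theorem ghost_loop_mul_exitPath_succ (f : E.Exit τ) (n : ℕ) :
    gen K E (ghost τ) * exitPath K f (n + 1) = exitPath K f n := by
  rw [exitPath, ← mul_assoc, (isCuntzKriegerFamily_gen K E).ghost_edge_self, ← hτ.1,
    source_mul_exitPath]

include hτ in
theorem exitGhost_succ_mul_loop (f : E.Exit τ) (n : ℕ) :
    exitGhost K f (n + 1) * gen K E (edge τ) = exitGhost K f n := by
  rw [exitGhost, mul_assoc, (isCuntzKriegerFamily_gen K E).ghost_edge_self, ← hτ.1,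
    exitGhost_mul_source]

theorem ghost_loop_mul_exitPath_zero (f : E.Exit τ) :
    gen K E (ghost τ) * exitPath K f 0 = 0 :=
  (isCuntzKriegerFamily_gen K E).ghost_edge_ne _ _ f.2.2.symm

theorem exitGhost_zero_mul_loop (f : E.Exit τ) :
    exitGhost K f 0 * gen K E (edge τ) = 0 :=
  (isCuntzKriegerFamily_gen K E).ghost_edge_ne _ _ f.2.2

theorem exitGhost_succ_mul_exit (f f' : E.Exit τ) (n : ℕ) :
    exitGhost K f (n + 1) * gen K E (edge f'.1) = 0 := by
  rw [exitGhost, mul_assoc, (isCuntzKriegerFamily_gen K E).ghost_edge_ne _ _ f'.2.2.symm, mul_zero]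

theorem ghost_exit_mul_exitPath_succ (f f' : E.Exit τ) (n : ℕ) :
    gen K E (ghost f'.1) * exitPath K f (n + 1) = 0 := by
  rw [exitPath, ← mul_assoc, (isCuntzKriegerFamily_gen K E).ghost_edge_ne _ _ f'.2.2, zero_mul]

include hτ in
theorem exitGhost_mul_exitPath_self (f : E.Exit τ) (n : ℕ) :
    exitGhost K f n * exitPath K f n = gen K E (vert (E.r f.1)) := by
  induction n with
  | zero => exact (isCuntzKriegerFamily_gen K E).ghost_edge_self _
  | succ n ih => rw [exitGhost, mul_assoc, ghost_loop_mul_exitPath_succ K hτ, ih]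

-- Cancel τ*τ = t until one of the two powers of τ is used up. What remains contains f*f' with f ≠
-- f', f*τ or τ*f', all of which vanish.
include hτ in
theorem exitGhost_mul_exitPath_ne {f f' : E.Exit τ} {n m : ℕ} (h : (n, f) ≠ (m, f')) :
    exitGhost K f n * exitPath K f' m = 0 := by
  induction n generalizing m with
  | zero =>
    cases m with
    | zero =>
      refine (isCuntzKriegerFamily_gen K E).ghost_edge_ne _ _ fun h' => h ?_
      rw [Subtype.ext h']
    | succ m => exact ghost_exit_mul_exitPath_succ K f' f m
  | succ n ih =>
    cases m with
    | zero => exact exitGhost_succ_mul_exit K f f' n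
    | succ m =>
      rw [exitGhost, mul_assoc, ghost_loop_mul_exitPath_succ K hτ]
      exact ih fun h' => h (by simpa using h')

variable [Finite V]

/-- The paths from the base of a source loop to its complement, with the identity of the
restricted algebra added. -/
noncomputable def exitLeft : Option (ℕ × E.Exit τ) → LeavittPathAlgebra K E
  | none => restrictHom K hτ.hereditary 1
  | some k => exitPath K k.2 k.1

/-- The ghost paths from the complement of a source loop to its base, with the identity of the
restricted algebra added. -/
noncomputable def exitRight : Option (ℕ × E.Exit τ) → LeavittPathAlgebra K E
  | none => restrictHom K hτ.hereditary 1
  | some k => exitGhost K k.2 k.1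

variable {K} in
theorem restrictHom_one_mul_of_mem {a : V} (ha : a ∈ ({E.s τ}ᶜ : Set V))
    {z : LeavittPathAlgebra K E} (hz : gen K E (vert a) * z = z) :
    restrictHom K hτ.hereditary 1 * z = z := by
  rw [restrictHom_one, ← hz, ← mul_assoc]
  congr 1
  exact vertexSum_mul_ofVert K E _ ha

variable {K} in
theorem mul_restrictHom_one_of_mem {a : V} (ha : a ∈ ({E.s τ}ᶜ : Set V))
    {z : LeavittPathAlgebra K E} (hz : z * gen K E (vert a) = z) :
    z * restrictHom K hτ.hereditary 1 = z := by
  rw [restrictHom_one, ← hz, mul_assoc]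
  congr 1
  exact ofVert_mul_vertexSum K E _ ha

theorem restrictHom_one_mul_source :
    restrictHom K hτ.hereditary 1 * gen K E (vert (E.s τ)) = 0 :=
  map_one_mul_eq_zero _ fun a => by
    rw [ofVert, restrictHom_gen]
    exact (isCuntzKriegerFamily_gen K E).vert_orth _ _ a.2

theorem source_mul_restrictHom_one :
    gen K E (vert (E.s τ)) * restrictHom K hτ.hereditary 1 = 0 :=
  mul_map_one_eq_zero _ fun a => by
    rw [ofVert, restrictHom_gen]
    exact (isCuntzKriegerFamily_gen K E).vert_orth _ _ (Ne.symm a.2)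

variable {K} in
theorem restrictHom_one_mul_eq_zero {z : LeavittPathAlgebra K E}
    (hz : gen K E (vert (E.s τ)) * z = z) : restrictHom K hτ.hereditary 1 * z = 0 := by
  rw [← hz, ← mul_assoc, restrictHom_one_mul_source K hτ, zero_mul]

variable {K} in
theorem mul_restrictHom_one_eq_zero {z : LeavittPathAlgebra K E}
    (hz : z * gen K E (vert (E.s τ)) = z) : z * restrictHom K hτ.hereditary 1 = 0 := by
  rw [← hz, mul_assoc, source_mul_restrictHom_one K hτ, mul_zero]

theorem restrictHom_one_mul_exitRight (k : Option (ℕ × E.Exit τ)) :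
    restrictHom K hτ.hereditary 1 * exitRight K hτ k = exitRight K hτ k := by
  rcases k with _ | ⟨n, f⟩
  · exact map_one_mul_map _ _
  · exact restrictHom_one_mul_of_mem hτ (hτ.range_exit_mem f) (range_mul_exitGhost K f n)

theorem exitLeft_mul_restrictHom_one (k : Option (ℕ × E.Exit τ)) :
    exitLeft K hτ k * restrictHom K hτ.hereditary 1 = exitLeft K hτ k := by
  rcases k with _ | ⟨n, f⟩
  · exact map_mul_map_one _ _
  · exact mul_restrictHom_one_of_mem hτ (hτ.range_exit_mem f) (exitPath_mul_range K f n)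

theorem exitRight_some_mul_restrictHom_one (k : ℕ × E.Exit τ) :
    exitRight K hτ (some k) * restrictHom K hτ.hereditary 1 = 0 :=
  mul_restrictHom_one_eq_zero hτ (exitGhost_mul_source K k.2 k.1)

theorem restrictHom_one_mul_exitLeft_some (k : ℕ × E.Exit τ) :
    restrictHom K hτ.hereditary 1 * exitLeft K hτ (some k) = 0 :=
  restrictHom_one_mul_eq_zero hτ (source_mul_exitPath K k.2 k.1)

/-- This is the input to `mul_mem_span`: ghost paths from H to t can only be lengthened by τ*,
shortened by τ, or closed up by their own exit. -/
theorem exitRight_mul_gen (k : Option (ℕ × E.Exit τ)) (g : LeavittGen V Ed) :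
    exitRight K hτ k * gen K E g = 0 ∨ ∃ a l, exitRight K hτ k * gen K E g
      = restrictHom K hτ.hereditary a * exitRight K hτ l := by
  have ck := isCuntzKriegerFamily_gen K E
  rcases k with _ | ⟨n, f⟩
  · have key (g) : ∃ a l, exitRight K hτ none * gen K E (restrictGen g)
        = restrictHom K hτ.hereditary a * exitRight K hτ l :=
      ⟨gen K _ g, none, by
        rw [← restrictHom_gen K hτ.hereditary, exitRight, map_one_mul_map, map_mul_map_one]⟩
    rcases g with a | e | e
    · by_cases ha : a = E.s τ
      · subst ha
        exact .inl (restrictHom_one_mul_source K hτ)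
      · exact .inr (key (vert ⟨a, ha⟩))
    · by_cases he : E.s e = E.s τ
      · exact .inl (restrictHom_one_mul_eq_zero hτ (he ▸ ck.source_edge e))
      · exact .inr (key (edge ⟨e, he⟩))
    · by_cases he : E.s e = E.s τ
      · by_cases h : e = τ
        · subst h
          exact .inl (restrictHom_one_mul_eq_zero hτ (hτ.1 ▸ ck.range_ghost e))
        -- The product ρ e* is literally φ(1) times the ghost path with n = 0.
        · exact .inr ⟨1, some (0, ⟨e, he, h⟩), rfl⟩
      · exact .inr (key (ghost ⟨e, he⟩))
  · have h1 (k) : exitRight K hτ k = restrictHom K hτ.hereditary 1 * exitRight K hτ k :=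
      (restrictHom_one_mul_exitRight K hτ k).symm
    rcases g with a | e | e
    · by_cases ha : a = E.s τ
      · subst ha
        exact .inr ⟨1, some (n, f), (exitGhost_mul_source K f n).trans (h1 (some (n, f)))⟩
      · exact .inl (exitGhost_mul_eq_zero (ck.vert_orth _ _ (Ne.symm ha)) f n)
    · by_cases he : E.s e = E.s τ
      · by_cases h : e = τ
        · subst h
          cases n with
          | zero => exact .inl (exitGhost_zero_mul_loop K f)
          | succ n =>
            exact .inr ⟨1, some (n, f), (exitGhost_succ_mul_loop K hτ f n).trans (h1 (some (n, f)))⟩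
        · cases n with
          | zero =>
            by_cases hf : f.1 = e
            · subst hf
              refine .inr ⟨gen K _ (vert ⟨E.r f.1, hτ.range_exit_mem f⟩), none, ?_⟩
              rw [exitRight, exitRight, map_mul_map_one, restrictHom_gen]
              exact ck.ghost_edge_self _
            · exact .inl (ck.ghost_edge_ne _ _ hf)
          | succ n => exact .inl (exitGhost_succ_mul_exit K f ⟨e, he, h⟩ n)
      · exact .inl (exitGhost_mul_eq_zero (ck.vert_mul_edge_ne (Ne.symm he)) f n)
    · by_cases he : E.r e = E.s τ
      -- Here the absence of entrances is decisive: e* can follow a ghost path ending at t only if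
      -- r(e) = t, that is, only if e = τ.
      · obtain rfl := hτ.2 e he
        exact .inr ⟨1, some (n + 1, f), h1 (some (n + 1, f))⟩
      · exact .inl (exitGhost_mul_eq_zero (ck.vert_mul_ghost_ne (Ne.symm he)) f n)

theorem gen_mul_exitLeft (g : LeavittGen V Ed) (k : Option (ℕ × E.Exit τ)) :
    gen K E g * exitLeft K hτ k = 0 ∨ ∃ a l, gen K E g * exitLeft K hτ k
      = exitLeft K hτ l * restrictHom K hτ.hereditary a := by
  have ck := isCuntzKriegerFamily_gen K E
  have h1 (k) : exitLeft K hτ k = exitLeft K hτ k * restrictHom K hτ.hereditary 1 :=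
    (exitLeft_mul_restrictHom_one K hτ k).symm
  rcases k with _ | ⟨n, f⟩
  · have key (g) : ∃ a l, gen K E (restrictGen g) * exitLeft K hτ none
        = exitLeft K hτ l * restrictHom K hτ.hereditary a :=
      ⟨gen K _ g, none, by
        rw [← restrictHom_gen K hτ.hereditary, exitLeft, map_one_mul_map, map_mul_map_one]⟩
    rcases g with a | e | e
    · by_cases ha : a = E.s τ
      · subst ha
        exact .inl (source_mul_restrictHom_one K hτ)
      · exact .inr (key (vert ⟨a, ha⟩))
    · by_cases he : E.s e = E.s τ
      · by_cases h : e = τ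
        · subst h
          exact .inl (mul_restrictHom_one_eq_zero hτ (hτ.1 ▸ ck.edge_range e))
        · refine .inr ⟨1, some (0, ⟨e, he, h⟩), rfl⟩
      · exact .inr (key (edge ⟨e, he⟩))
    · by_cases he : E.s e = E.s τ
      · exact .inl (mul_restrictHom_one_eq_zero hτ (he ▸ ck.ghost_source e))
      · exact .inr (key (ghost ⟨e, he⟩))
  · rcases g with a | e | e
    · by_cases ha : a = E.s τ
      · subst ha
        exact .inr ⟨1, some (n, f), (source_mul_exitPath K f n).trans (h1 (some (n, f)))⟩
      · exact .inl (mul_exitPath_eq_zero (ck.vert_orth _ _ ha) f n)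
    · by_cases he : E.r e = E.s τ
      · obtain rfl := hτ.2 e he
        exact .inr ⟨1, some (n + 1, f), h1 (some (n + 1, f))⟩
      · exact .inl (mul_exitPath_eq_zero (ck.edge_mul_vert_ne he) f n)
    · by_cases he : E.s e = E.s τ
      · by_cases h : e = τ
        · subst h
          cases n with
          | zero => exact .inl (ghost_loop_mul_exitPath_zero K f)
          | succ n =>
            exact .inr ⟨1, some (n, f),
              (ghost_loop_mul_exitPath_succ K hτ f n).trans (h1 (some (n, f)))⟩
        · cases n with
          | zero =>
            by_cases hf : e = f.1
            · subst hf
              refine .inr ⟨gen K _ (vert ⟨E.r f.1, hτ.range_exit_mem f⟩), none, ?_⟩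
              rw [exitLeft, exitLeft, map_one_mul_map, restrictHom_gen]
              exact ck.ghost_edge_self _
            · exact .inl (ck.ghost_edge_ne _ _ hf)
          | succ n => exact .inl (ghost_exit_mul_exitPath_succ K f ⟨e, he, h⟩ n)
      · exact .inl (mul_exitPath_eq_zero (ck.ghost_mul_vert_ne he) f n)

theorem exit_corner (b : LeavittPathAlgebra K E) :
    ∃ a, restrictHom K hτ.hereditary 1 * b * restrictHom K hτ.hereditary 1
      = restrictHom K hτ.hereditary a := by
  refine exists_corner_eq (exitRight_mul_gen K hτ) ?_ (k₀ := none) rfl b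
  rintro (_ | k)
  · exact ⟨1, map_one_mul_map _ _⟩
  · exact ⟨0, by rw [map_zero]; exact exitRight_some_mul_restrictHom_one K hτ k⟩

theorem exitRight_mul_exitLeft_ne {k l : Option (ℕ × E.Exit τ)} (h : k ≠ l) :
    exitRight K hτ k * exitLeft K hτ l = 0 := by
  rcases k with _ | k <;> rcases l with _ | l
  · exact absurd rfl h
  · exact restrictHom_one_mul_exitLeft_some K hτ l
  · exact exitRight_some_mul_restrictHom_one K hτ k
  · exact exitGhost_mul_exitPath_ne K hτ (by simpa using h)

theorem exitLeft_mul_exitRight_mul_exitLeft (k : Option (ℕ × E.Exit τ)) :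
    exitLeft K hτ k * exitRight K hτ k * exitLeft K hτ k = exitLeft K hτ k := by
  rcases k with _ | ⟨n, f⟩
  · rw [exitLeft, exitRight, map_one_mul_map, map_one_mul_map]
  · rw [exitLeft, exitRight, mul_assoc, exitGhost_mul_exitPath_self K hτ, exitPath_mul_range]

theorem exitRight_mul_exitLeft_mul_exitRight (k : Option (ℕ × E.Exit τ)) :
    exitRight K hτ k * (exitLeft K hτ k * exitRight K hτ k) = exitRight K hτ k := by
  rcases k with _ | ⟨n, f⟩
  · rw [exitLeft, exitRight, map_one_mul_map, map_one_mul_map]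
  · rw [exitLeft, exitRight, ← mul_assoc, exitGhost_mul_exitPath_self K hτ, range_mul_exitGhost]

/-- I is additively spanned by products b ρ c, and b ρ is a combination of terms x_l φ(a). The
relations y_k x_l = 0 for k ≠ l and x_l y_l x_l = x_l show that any partial sum containing l fixes
such a term. -/
theorem exit_left_unit {z : LeavittPathAlgebra K E} (hz : z ∈ vertexIdeal K E {E.s τ}ᶜ) :
    ∀ᶠ s : Finset (Option (ℕ × E.Exit τ)) in atTop,
      (∑ k ∈ s, exitLeft K hτ k * exitRight K hτ k) * z = z := by
  rw [vertexIdeal, TwoSidedIdeal.mem_span_iff_mem_addSubgroup_closure] at hz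
  induction hz using AddSubgroup.closure_induction with
  | mem z hz =>
    obtain ⟨_, ⟨b, -, _, rfl, rfl⟩, c, -, rfl⟩ := hz
    -- The index `none` makes b x_k equal to b ρ.
    have h := mem_span_mul (gen_mul_exitLeft K hτ) b none
    rw [exitLeft, restrictHom_one] at h
    dsimp only
    generalize b * vertexSum K E {E.s τ}ᶜ = z at h
    suffices ∀ᶠ s : Finset (Option (ℕ × E.Exit τ)) in atTop,
        (∑ k ∈ s, exitLeft K hτ k * exitRight K hτ k) * z = z by
      filter_upwards [this] with s hs
      rw [← mul_assoc, hs]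
    induction h using Submodule.span_induction with
    | mem z hz =>
      obtain ⟨a, l, rfl⟩ := hz
      filter_upwards [eventually_ge_atTop {l}] with s hs
      rw [Finset.singleton_subset_iff] at hs
      rw [← mul_assoc, Finset.sum_mul, Finset.sum_eq_single_of_mem l hs,
        exitLeft_mul_exitRight_mul_exitLeft]
      intro k _ hk
      rw [mul_assoc, exitRight_mul_exitLeft_ne K hτ hk, mul_zero]
    | zero => exact Eventually.of_forall fun s => mul_zero _
    | add p q _ _ hp hq =>
      filter_upwards [hp, hq] with s hs hs'
      rw [mul_add, hs, hs']
    | smul c p _ hp =>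
      filter_upwards [hp] with s hs
      rw [mul_smul_comm, hs]
  | zero => exact Eventually.of_forall fun s => mul_zero _
  | add p q _ _ hp hq =>
    filter_upwards [hp, hq] with s hs hs'
    rw [mul_add, hs, hs']
  | neg p _ hp =>
    filter_upwards [hp] with s hs
    rw [mul_neg, hs]

theorem exit_right_unit {z : LeavittPathAlgebra K E} (hz : z ∈ vertexIdeal K E {E.s τ}ᶜ) :
    ∀ᶠ s : Finset (Option (ℕ × E.Exit τ)) in atTop,
      z * (∑ k ∈ s, exitLeft K hτ k * exitRight K hτ k) = z := by
  rw [vertexIdeal, TwoSidedIdeal.mem_span_iff_mem_addSubgroup_closure] at hz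
  induction hz using AddSubgroup.closure_induction with
  | mem z hz =>
    obtain ⟨_, ⟨b, -, _, rfl, rfl⟩, c, -, rfl⟩ := hz
    have h := mul_mem_span (exitRight_mul_gen K hτ) none c
    rw [exitRight, restrictHom_one] at h
    dsimp only
    rw [mul_assoc]
    generalize vertexSum K E {E.s τ}ᶜ * c = z at h
    suffices ∀ᶠ s : Finset (Option (ℕ × E.Exit τ)) in atTop,
        z * (∑ k ∈ s, exitLeft K hτ k * exitRight K hτ k) = z by
      filter_upwards [this] with s hs
      rw [mul_assoc, hs]
    induction h using Submodule.span_induction with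
    | mem z hz =>
      obtain ⟨a, l, rfl⟩ := hz
      filter_upwards [eventually_ge_atTop {l}] with s hs
      rw [Finset.singleton_subset_iff] at hs
      rw [mul_assoc, Finset.mul_sum, Finset.sum_eq_single_of_mem l hs,
        exitRight_mul_exitLeft_mul_exitRight]
      intro k _ hk
      rw [← mul_assoc, exitRight_mul_exitLeft_ne K hτ hk.symm, zero_mul]
    | zero => exact Eventually.of_forall fun s => zero_mul _
    | add p q _ _ hp hq =>
      filter_upwards [hp, hq] with s hs hs'
      rw [add_mul, hs, hs']
    | smul c p _ hp =>
      filter_upwards [hp] with s hs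
      rw [smul_mul_assoc, hs]
  | zero => exact Eventually.of_forall fun s => zero_mul _
  | add p q _ _ hp hq =>
    filter_upwards [hp, hq] with s hs hs'
    rw [add_mul, hs, hs']
  | neg p _ hp =>
    filter_upwards [hp] with s hs
    rw [neg_mul, hs]

theorem restrictHom_one_mem :
    restrictHom K hτ.hereditary 1 ∈ vertexIdeal K E {E.s τ}ᶜ := by
  rw [restrictHom_one]
  exact TwoSidedIdeal.subset_span rfl

theorem restrictHom_mem (a : LeavittPathAlgebra K (E.restrict {E.s τ}ᶜ hτ.hereditary)) :
    restrictHom K hτ.hereditary a ∈ vertexIdeal K E {E.s τ}ᶜ := by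
  rw [← map_mul_map_one]
  exact (vertexIdeal K E _).mul_mem_left _ _ (restrictHom_one_mem K hτ)

theorem exitLeft_mem (k : Option (ℕ × E.Exit τ)) :
    exitLeft K hτ k ∈ vertexIdealAlgebra K E {E.s τ}ᶜ := by
  rw [← exitLeft_mul_restrictHom_one]
  exact (vertexIdeal K E _).mul_mem_left _ _ (restrictHom_one_mem K hτ)

theorem exitRight_mem (k : Option (ℕ × E.Exit τ)) :
    exitRight K hτ k ∈ vertexIdealAlgebra K E {E.s τ}ᶜ := by
  rw [← restrictHom_one_mul_exitRight]
  exact (vertexIdeal K E _).mul_mem_right _ _ (restrictHom_one_mem K hτ)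

/-- The canonical homomorphism from the restricted algebra, with values in the ideal generated by
its identity. -/
noncomputable def restrictHomIdeal : LeavittPathAlgebra K (E.restrict {E.s τ}ᶜ hτ.hereditary) →ₙₐ[K]
    vertexIdealAlgebra K E {E.s τ}ᶜ :=
  NonUnitalAlgHom.codRestrict (restrictHom K hτ.hereditary) _ (restrictHom_mem K hτ)

theorem exit_isCornerFrame :
    IsCornerFrame (restrictHomIdeal K hτ :
        LeavittPathAlgebra K (E.restrict {E.s τ}ᶜ hτ.hereditary) →ₙ+*
          vertexIdealAlgebra K E {E.s τ}ᶜ)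
      (fun k => ⟨exitLeft K hτ k, exitLeft_mem K hτ k⟩)
      (fun k => ⟨exitRight K hτ k, exitRight_mem K hτ k⟩) where
  x_corner k := Subtype.ext (exitLeft_mul_restrictHom_one K hτ k)
  corner_y k := Subtype.ext (restrictHom_one_mul_exitRight K hτ k)
  corner b := (exit_corner K hτ b.1).imp fun _ h => Subtype.ext h
  left_unit b := by
    filter_upwards [exit_left_unit K hτ b.2] with s hs
    refine Subtype.ext (Eq.trans ?_ hs)
    push_cast
    rfl
  right_unit b := by
    filter_upwards [exit_right_unit K hτ b.2] with s hs
    refine Subtype.ext (Eq.trans ?_ hs)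
    push_cast
    rfl

end SourceLoop

end LeavittPathAlgebra

/-! ### The homomorphism from the hedgehog algebra to I. -/

namespace DirectedGraph

variable {V : Type v} {Ed : Type w} {E : DirectedGraph V Ed} {τ : Ed}

/-- A vertex either is the base of the loop or belongs to its complement. -/
theorem vert_cases {P : V → Prop} (mem : ∀ a : ({E.s τ}ᶜ : Set V), P a) (source : P (E.s τ))
    (a : V) : P a := by
  by_cases h : a = E.s τ
  · exact h ▸ source
  · exact mem ⟨a, h⟩

/-- An edge is the loop, one of its exits, or an edge of the restricted graph. -/
theorem edge_cases {P : Ed → Prop} (mem : ∀ e : {e : Ed // E.s e ∈ ({E.s τ}ᶜ : Set V)}, P e.1)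
    (loop : P τ) (exit : ∀ f : E.Exit τ, P f.1) (e : Ed) : P e := by
  by_cases h : E.s e = E.s τ
  · by_cases h' : e = τ
    · exact h' ▸ loop
    · exact exit ⟨e, h, h'⟩
  · exact mem ⟨e, h⟩

end DirectedGraph

namespace LeavittPathAlgebra

section HedgehogIso

variable (K : Type u) [Field K] {V : Type v} {Ed : Type w} {E : DirectedGraph V Ed}
  {τ : Ed} (hτ : E.IsSourceLoop τ)

/-- The hedgehog graph of a source loop: a new vertex for each path `τ ^ n f`, with `f` an exit of
`τ`, is attached to the graph restricted to the complement of the base of `τ`. -/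
abbrev exitHedgehog : DirectedGraph (({E.s τ}ᶜ : Set V) ⊕ (ℕ × E.Exit τ))
    ({e : Ed // E.s e ∈ ({E.s τ}ᶜ : Set V)} ⊕ (ℕ × E.Exit τ)) :=
  (E.restrict {E.s τ}ᶜ hτ.hereditary).hedgehog fun k => ⟨E.r k.2.1, hτ.range_exit_mem k.2⟩

/-- The images in `L_K(E)` of the generating symbols of the hedgehog graph of a source loop. -/
noncomputable def hedgehogFamily : LeavittGen (({E.s τ}ᶜ : Set V) ⊕ (ℕ × E.Exit τ))
    ({e : Ed // E.s e ∈ ({E.s τ}ᶜ : Set V)} ⊕ (ℕ × E.Exit τ)) → LeavittPathAlgebra K E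
  | vert (Sum.inl a) => gen K E (vert a.1)
  | vert (Sum.inr k) => exitPath K k.2 k.1 * exitGhost K k.2 k.1
  | edge (Sum.inl e) => gen K E (edge e.1)
  | edge (Sum.inr k) => exitPath K k.2 k.1
  | ghost (Sum.inl e) => gen K E (ghost e.1)
  | ghost (Sum.inr k) => exitGhost K k.2 k.1

/-- The new vertex for τ^n f is realised by the idempotent τ^n f f*(τ*)^n. Orthogonality of the exit
paths gives the relations among new symbols; the others come from E_H or from vertices meeting at
different places. -/
theorem isCuntzKriegerFamily_hedgehogFamily :
    IsCuntzKriegerFamily (exitHedgehog hτ) (hedgehogFamily (E := E) (τ := τ) K) := by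
  have ck := isCuntzKriegerFamily_gen K E
  have ck' := isCuntzKriegerFamily_restrict K hτ.hereditary
  refine ⟨?_, ?_, ?_, ?_, ?_, ?_, ?_, ?_, ?_⟩
  · rintro (a | k)
    · exact ck.vert_idem _
    · rw [hedgehogFamily, mul_assoc, ← mul_assoc (exitGhost K _ _),
        exitGhost_mul_exitPath_self K hτ, range_mul_exitGhost]
  · rintro (a | k) (b | l) h
    · exact ck'.vert_orth a b (by simpa using h)
    · rw [hedgehogFamily, hedgehogFamily, ← mul_assoc,
        mul_exitPath_eq_zero (ck.vert_orth _ _ a.2), zero_mul]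
    · rw [hedgehogFamily, hedgehogFamily, mul_assoc,
        exitGhost_mul_eq_zero (ck.vert_orth _ _ (Ne.symm b.2)), mul_zero]
    · rw [hedgehogFamily, hedgehogFamily, mul_assoc, ← mul_assoc (exitGhost K _ _),
        exitGhost_mul_exitPath_ne K hτ (by simpa using h), zero_mul, mul_zero]
  · rintro (e | k)
    · exact ck'.source_edge e
    · change exitPath K k.2 k.1 * exitGhost K k.2 k.1 * exitPath K k.2 k.1 = exitPath K k.2 k.1
      rw [mul_assoc, exitGhost_mul_exitPath_self K hτ, exitPath_mul_range]
  · rintro (e | k)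
    · exact ck'.edge_range e
    · exact exitPath_mul_range K k.2 k.1
  · rintro (e | k)
    · exact ck'.range_ghost e
    · exact range_mul_exitGhost K k.2 k.1
  · rintro (e | k)
    · exact ck'.ghost_source e
    · change exitGhost K k.2 k.1 * (exitPath K k.2 k.1 * exitGhost K k.2 k.1) = exitGhost K k.2 k.1
      rw [← mul_assoc, exitGhost_mul_exitPath_self K hτ, range_mul_exitGhost]
  · rintro (e | k)
    · exact ck'.ghost_edge_self e
    · exact exitGhost_mul_exitPath_self K hτ k.2 k.1
  · rintro (e | k) (e' | l) h
    · exact ck'.ghost_edge_ne e e' (by simpa using h)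
    · exact mul_exitPath_eq_zero (ck.ghost_mul_vert_ne e.2) _ _
    · exact exitGhost_mul_eq_zero (ck.vert_mul_edge_ne (Ne.symm e'.2)) _ _
    · exact exitGhost_mul_exitPath_ne K hτ (by simpa using h)
  · rintro (a | k) hfin hne
    · have h := DirectedGraph.hedgehog_s_preimage_inl (E.restrict {E.s τ}ᶜ hτ.hereditary)
        (fun k : ℕ × E.Exit τ => ⟨E.r k.2.1, hτ.range_exit_mem k.2⟩) a
      have hfin' : ((E.restrict {E.s τ}ᶜ hτ.hereditary).s ⁻¹' {a}).Finite :=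
        Set.Finite.of_finite_image (h ▸ hfin) Sum.inl_injective.injOn
      have hne' : ((E.restrict {E.s τ}ᶜ hτ.hereditary).s ⁻¹' {a}).Nonempty :=
        Set.image_nonempty.1 (h ▸ hne)
      have : hfin.toFinset = hfin'.toFinset.map ⟨Sum.inl, Sum.inl_injective⟩ := by
        ext; simp [h]
      rw [this, Finset.sum_map]
      exact ck'.regular_vert a hfin' hne'
    · have h := DirectedGraph.hedgehog_s_preimage_inr (E.restrict {E.s τ}ᶜ hτ.hereditary)
        (fun k : ℕ × E.Exit τ => ⟨E.r k.2.1, hτ.range_exit_mem k.2⟩) k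
      have : hfin.toFinset = {Sum.inr k} := by ext; simp [h]
      rw [this, Finset.sum_singleton]
      rfl

variable [Finite V]

include hτ in
theorem hedgehogFamily_mem (g) :
    hedgehogFamily (E := E) (τ := τ) K g ∈ vertexIdealAlgebra K E {E.s τ}ᶜ := by
  have h (g) : gen K E (restrictGen g) ∈ vertexIdealAlgebra K E {E.s τ}ᶜ :=
    restrictHom_gen K hτ.hereditary g ▸ restrictHom_mem K hτ _
  rcases g with (a | k) | (e | k) | (e | k)
  · exact h (vert a)
  · exact mul_mem (exitLeft_mem K hτ (some k)) (exitRight_mem K hτ (some k))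
  · exact h (edge e)
  · exact exitLeft_mem K hτ (some k)
  · exact h (ghost e)
  · exact exitRight_mem K hτ (some k)

theorem hedgehogLift_mem (b : LeavittPathAlgebra K (exitHedgehog hτ)) :
    lift K _ (isCuntzKriegerFamily_hedgehogFamily K hτ) b ∈ vertexIdealAlgebra K E {E.s τ}ᶜ := by
  induction b using LeavittPathAlgebra.induction with
  | zero => rw [map_zero]; exact zero_mem _
  | add p q hp hq => rw [map_add]; exact add_mem hp hq
  | smul c p hp => rw [map_smul]; exact SMulMemClass.smul_mem c hp
  | gen g => rw [lift_gen]; exact hedgehogFamily_mem K hτ g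
  | gen_mul g p hp =>
    rw [map_mul, lift_gen]
    exact mul_mem (hedgehogFamily_mem K hτ g) hp

/-- The homomorphism from the Leavitt path algebra of the hedgehog graph of a source loop to the
ideal generated by the vertices different from the base of the loop. -/
noncomputable def hedgehogToIdeal :
    LeavittPathAlgebra K (exitHedgehog hτ) →ₙₐ[K] vertexIdealAlgebra K E {E.s τ}ᶜ :=
  NonUnitalAlgHom.codRestrict (lift K _ (isCuntzKriegerFamily_hedgehogFamily K hτ)) _
    (hedgehogLift_mem K hτ)

theorem hedgehogToIdeal_hedgehogHom
    (a : LeavittPathAlgebra K (E.restrict {E.s τ}ᶜ hτ.hereditary)) :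
    hedgehogToIdeal K hτ (hedgehogHom K _ _ a) = restrictHomIdeal K hτ a := by
  have hgen (g) : hedgehogToIdeal K hτ (hedgehogHom K _ _ (gen K _ g))
      = restrictHomIdeal K hτ (gen K _ g) := by
    refine Subtype.ext ?_
    change lift K _ (isCuntzKriegerFamily_hedgehogFamily K hτ) (hedgehogHom K _ _ (gen K _ g))
      = restrictHom K hτ.hereditary (gen K _ g)
    rw [hedgehogHom_gen, lift_gen, restrictHom_gen]
    cases g <;> rfl
  induction a using LeavittPathAlgebra.induction with
  | zero => simp only [map_zero]
  | add p q hp hq => simp only [map_add, hp, hq]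
  | smul c p hp => simp only [map_smul, hp]
  | gen g => exact hgen g
  | gen_mul g p hp => simp only [map_mul, hp, hgen]

end HedgehogIso

/-! ### The L_K(E)-module induced from an L_K(E_H)-module. -/

section ExitModule

variable (K : Type u) [Field K] {V : Type v} {Ed : Type w} {E : DirectedGraph V Ed}
  {τ : Ed} (hτ : E.IsSourceLoop τ) [Finite V] {N : Type x} [AddCommGroup N] [Module K N]
  [Module (LeavittPathAlgebra K (E.restrict {E.s τ}ᶜ hτ.hereditary)) N]
  [IsScalarTower K (LeavittPathAlgebra K (E.restrict {E.s τ}ᶜ hτ.hereditary)) N]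

/-- The range of an exit, as an element of the restricted algebra. -/
noncomputable def exitVert (f : E.Exit τ) :
    LeavittPathAlgebra K (E.restrict {E.s τ}ᶜ hτ.hereditary) :=
  gen K _ (vert ⟨E.r f.1, hτ.range_exit_mem f⟩)

omit [Module K N] [IsScalarTower K (LeavittPathAlgebra K (E.restrict {E.s τ}ᶜ hτ.hereditary)) N] in
theorem exitVert_smul_smul (f : E.Exit τ) (n : N) :
    exitVert K hτ f • exitVert K hτ f • n = exitVert K hτ f • n := by
  rw [smul_smul]
  congr 1
  exact (isCuntzKriegerFamily_gen K _).vert_idem _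

theorem exitVert_smul_comm (f : E.Exit τ) (c : K) (n : N) :
    exitVert K hτ f • c • n = c • exitVert K hτ f • n := smul_algebra_smul_comm c _ n

/-- The module on which `L_K(E)` acts: a copy of `N` at the vertices different from the base of the
loop, and a copy of `N` for each path `τ ^ n f`. -/
abbrev ExitModule {V : Type v} {Ed : Type w} (E : DirectedGraph V Ed) (τ : Ed) (N : Type x) : Type (max w x) :=
  N × (ℕ → E.Exit τ → N)

namespace ExitModule

/-- The action of the restricted algebra on the copy of `N` at the vertices different from the base
of the loop. -/
noncomputable def left (a : LeavittPathAlgebra K (E.restrict {E.s τ}ᶜ hτ.hereditary)) :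
    Module.End K (ExitModule E τ N) :=
  LinearMap.inl K N _ ∘ₗ Algebra.lsmul K K N a ∘ₗ LinearMap.fst K N _

/-- The action of the base of the loop. -/
noncomputable def proj : Module.End K (ExitModule E τ N) where
  toFun p := (0, fun n f => exitVert K hτ f • p.2 n f)
  map_add' p q := by ext <;> simp
  map_smul' c p := by ext <;> simp [exitVert_smul_comm]

/-- The action of the loop. -/
noncomputable def shift : Module.End K (ExitModule E τ N) where
  toFun p := (0, fun n f => n.casesOn 0 fun n => exitVert K hτ f • p.2 n f)
  map_add' p q := by ext (_ | n) <;> simp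
  map_smul' c p := by ext (_ | n) <;> simp [exitVert_smul_comm]

/-- The action of the ghost edge of the loop. -/
noncomputable def unshift : Module.End K (ExitModule E τ N) where
  toFun p := (0, fun n f => exitVert K hτ f • p.2 (n + 1) f)
  map_add' p q := by ext <;> simp
  map_smul' c p := by ext <;> simp [exitVert_smul_comm]

open Classical in
/-- The action of an exit. -/
noncomputable def enter (f : E.Exit τ) : Module.End K (ExitModule E τ N) where
  toFun p := (0, fun n f' => n.casesOn (if f = f' then exitVert K hτ f • p.1 else 0) fun _ => 0)
  map_add' p q := by
    ext (_ | n) f'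
    · simp
    · by_cases h : f = f' <;> simp [h]
    · simp
  map_smul' c p := by
    ext (_ | n) f'
    · simp
    · by_cases h : f = f' <;> simp [h, exitVert_smul_comm]
    · simp

/-- The action of the ghost edge of an exit. -/
noncomputable def leave (f : E.Exit τ) : Module.End K (ExitModule E τ N) where
  toFun p := (exitVert K hτ f • p.2 0 f, 0)
  map_add' p q := by ext <;> simp
  map_smul' c p := by ext <;> simp [exitVert_smul_comm]

theorem left_apply (a : LeavittPathAlgebra K (E.restrict {E.s τ}ᶜ hτ.hereditary))
    (p : ExitModule E τ N) : left K hτ a p = (a • p.1, 0) := rfl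

theorem proj_apply (p : ExitModule E τ N) :
    proj K hτ p = (0, fun n f => exitVert K hτ f • p.2 n f) := rfl

theorem shift_apply (p : ExitModule E τ N) : shift K hτ p
    = (0, fun n f => n.casesOn 0 fun n => exitVert K hτ f • p.2 n f) := rfl

theorem unshift_apply (p : ExitModule E τ N) :
    unshift K hτ p = (0, fun n f => exitVert K hτ f • p.2 (n + 1) f) := rfl

open Classical in
theorem enter_apply (f : E.Exit τ) (p : ExitModule E τ N) : enter K hτ f p = (0, fun n f' =>
    n.casesOn (if f = f' then exitVert K hτ f • p.1 else 0) fun _ => 0) := rfl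

theorem leave_apply (f : E.Exit τ) (p : ExitModule E τ N) :
    leave K hτ f p = (exitVert K hτ f • p.2 0 f, 0) := rfl

theorem left_mul (a b : LeavittPathAlgebra K (E.restrict {E.s τ}ᶜ hτ.hereditary)) :
    (left K hτ a * left K hτ b : Module.End K (ExitModule E τ N)) = left K hτ (a * b) :=
  LinearMap.ext fun p => by simp [left_apply, mul_smul]

theorem left_zero : (left K hτ 0 : Module.End K (ExitModule E τ N)) = 0 :=
  LinearMap.ext fun p => by simp [left_apply]

theorem left_sum {κ : Type*} (s : Finset κ)
    (a : κ → LeavittPathAlgebra K (E.restrict {E.s τ}ᶜ hτ.hereditary)) :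
    (left K hτ (∑ k ∈ s, a k) : Module.End K (ExitModule E τ N)) = ∑ k ∈ s, left K hτ (a k) := by
  refine LinearMap.ext fun p => ?_
  rw [LinearMap.sum_apply]
  simp only [left_apply]
  rw [Finset.sum_smul]
  ext <;> simp [Prod.fst_sum, Prod.snd_sum]

variable (N) in
open Classical in
/-- The action of the generating symbols. -/
noncomputable def family : LeavittGen V Ed → Module.End K (ExitModule E τ N)
  | vert a => if h : a ∈ ({E.s τ}ᶜ : Set V) then left K hτ (gen K _ (vert ⟨a, h⟩)) else proj K hτ
  | edge e => if h : E.s e ∈ ({E.s τ}ᶜ : Set V) then left K hτ (gen K _ (edge ⟨e, h⟩)) else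
      if h' : e = τ then shift K hτ else enter K hτ ⟨e, not_not.1 h, h'⟩
  | ghost e => if h : E.s e ∈ ({E.s τ}ᶜ : Set V) then left K hτ (gen K _ (ghost ⟨e, h⟩)) else
      if h' : e = τ then unshift K hτ else leave K hτ ⟨e, not_not.1 h, h'⟩

theorem family_restrictGen (g) :
    family K hτ N (restrictGen g) = left K hτ (gen K _ g) := by
  rcases g with a | e | e
  · exact dif_pos a.2
  · exact dif_pos e.2
  · exact dif_pos e.2

theorem family_source : family K hτ N (vert (E.s τ)) = proj K hτ :=
  dif_neg (by simp)

theorem family_loop : family K hτ N (edge τ) = shift K hτ := by simp [family]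

theorem family_ghost_loop : family K hτ N (ghost τ) = unshift K hτ := by simp [family]

theorem family_exit (f : E.Exit τ) : family K hτ N (edge f.1) = enter K hτ f := by
  simp [family, f.2.1, f.2.2]

theorem family_ghost_exit (f : E.Exit τ) : family K hτ N (ghost f.1) = leave K hτ f := by
  simp [family, f.2.1, f.2.2]

theorem family_source_exit (f : E.Exit τ) : family K hτ N (vert (E.s f.1)) = proj K hτ := by
  rw [f.2.1, family_source]

theorem family_range_exit (f : E.Exit τ) :
    family K hτ N (vert (E.r f.1)) = left K hτ (exitVert K hτ f) :=
  family_restrictGen K hτ (vert ⟨E.r f.1, hτ.range_exit_mem f⟩)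

theorem family_range_loop : family K hτ N (vert (E.r τ)) = proj K hτ := by
  rw [← hτ.1, family_source]

/-- The coordinate (n, f) stands for τ^n f ⊗ N, and only its r(f)-part matters, which is why every
operator at t multiplies by `exitVert`. The loop raises n, its ghost lowers n, and the exits
exchange n = 0 with the first factor. -/
theorem isCuntzKriegerFamily_family : IsCuntzKriegerFamily E (family K hτ N) := by
  classical
  have ck := isCuntzKriegerFamily_gen K (E.restrict {E.s τ}ᶜ hτ.hereditary)
  have hv := fun a => family_restrictGen (N := N) K hτ (vert a)
  have he := fun e => family_restrictGen (N := N) K hτ (edge e)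
  have hg := fun e => family_restrictGen (N := N) K hτ (ghost e)
  have hr := fun e => hv ((E.restrict {E.s τ}ᶜ hτ.hereditary).r e)
  have hs := fun e => hv ((E.restrict {E.s τ}ᶜ hτ.hereditary).s e)
  simp only [restrictGen] at hv he hg
  change ∀ e : {e // E.s e ∈ ({E.s τ}ᶜ : Set V)}, family K hτ N (vert (E.r e.1)) = _ at hr
  change ∀ e : {e // E.s e ∈ ({E.s τ}ᶜ : Set V)}, family K hτ N (vert (E.s e.1)) = _ at hs
  refine ⟨?_, ?_, ?_, ?_, ?_, ?_, ?_, ?_, ?_⟩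
  · refine DirectedGraph.vert_cases (τ := τ) (E := E) (fun a => ?_) ?_
    · rw [hv, left_mul, ck.vert_idem]
    · rw [family_source]
      refine LinearMap.ext fun p => ?_
      simp [proj_apply, exitVert_smul_smul]
  · refine DirectedGraph.vert_cases (τ := τ) (E := E) (fun a => ?_) ?_ <;>
      refine DirectedGraph.vert_cases (τ := τ) (E := E) (fun b => ?_) ?_
    · intro h
      rw [hv, hv, left_mul, ck.vert_orth _ _ fun h' => h (congrArg _ h'), left_zero]
    · intro
      rw [hv, family_source]
      exact LinearMap.ext fun p => by simp [proj_apply, left_apply]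
    · intro
      rw [hv, family_source]
      exact LinearMap.ext fun p => by ext <;> simp [proj_apply, left_apply]
    · exact fun h => absurd rfl h
  · refine DirectedGraph.edge_cases (τ := τ) (E := E) (fun e => ?_) ?_ fun f => ?_
    · rw [hs, he, left_mul, ck.source_edge]
    · rw [family_source, family_loop]
      refine LinearMap.ext fun p => ?_
      ext (_ | n) <;> simp [proj_apply, shift_apply, exitVert_smul_smul]
    · rw [family_source_exit, family_exit]
      refine LinearMap.ext fun p => ?_
      ext (_ | n) f'
      · rfl
      · by_cases h : f = f' <;> simp [proj_apply, enter_apply, h, exitVert_smul_smul]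
      · simp [proj_apply, enter_apply]
  · refine DirectedGraph.edge_cases (τ := τ) (E := E) (fun e => ?_) ?_ fun f => ?_
    · rw [hr, he, left_mul, ck.edge_range]
    · rw [family_range_loop, family_loop]
      refine LinearMap.ext fun p => ?_
      ext (_ | n) <;> simp [proj_apply, shift_apply, exitVert_smul_smul]
    · rw [family_range_exit, family_exit]
      refine LinearMap.ext fun p => ?_
      simp [left_apply, enter_apply, exitVert_smul_smul]
  · refine DirectedGraph.edge_cases (τ := τ) (E := E) (fun e => ?_) ?_ fun f => ?_
    · rw [hr, hg, left_mul, ck.range_ghost]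
    · rw [family_range_loop, family_ghost_loop]
      refine LinearMap.ext fun p => ?_
      simp [proj_apply, unshift_apply, exitVert_smul_smul]
    · rw [family_range_exit, family_ghost_exit]
      refine LinearMap.ext fun p => ?_
      simp [left_apply, leave_apply, exitVert_smul_smul]
  · refine DirectedGraph.edge_cases (τ := τ) (E := E) (fun e => ?_) ?_ fun f => ?_
    · rw [hs, hg, left_mul, ck.ghost_source]
    · rw [family_source, family_ghost_loop]
      refine LinearMap.ext fun p => ?_
      simp [proj_apply, unshift_apply, exitVert_smul_smul]
    · rw [family_source_exit, family_ghost_exit]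
      refine LinearMap.ext fun p => ?_
      simp [proj_apply, leave_apply, exitVert_smul_smul]
  · refine DirectedGraph.edge_cases (τ := τ) (E := E) (fun e => ?_) ?_ fun f => ?_
    · rw [hr, hg, he, left_mul, ck.ghost_edge_self]
    · rw [family_range_loop, family_ghost_loop, family_loop]
      refine LinearMap.ext fun p => ?_
      simp [proj_apply, unshift_apply, shift_apply, exitVert_smul_smul]
    · rw [family_range_exit, family_ghost_exit, family_exit]
      refine LinearMap.ext fun p => ?_
      simp [left_apply, leave_apply, enter_apply, exitVert_smul_smul]
  · refine DirectedGraph.edge_cases (τ := τ) (E := E) (fun e => ?_) ?_ fun f => ?_ <;>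
      refine DirectedGraph.edge_cases (τ := τ) (E := E) (fun e' => ?_) ?_ fun f' => ?_
    · intro h
      rw [hg, he, left_mul, ck.ghost_edge_ne _ _ fun h' => h (congrArg _ h'), left_zero]
    · intro
      rw [hg, family_loop]
      exact LinearMap.ext fun p => by simp [shift_apply, left_apply]
    · intro
      rw [hg, family_exit]
      exact LinearMap.ext fun p => by simp [enter_apply, left_apply]
    · intro
      rw [family_ghost_loop, he]
      exact LinearMap.ext fun p => by ext <;> simp [unshift_apply, left_apply]
    · exact fun h => absurd rfl h
    · intro
      rw [family_ghost_loop, family_exit]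
      exact LinearMap.ext fun p => by ext <;> simp [unshift_apply, enter_apply]
    · intro
      rw [family_ghost_exit, he]
      exact LinearMap.ext fun p => by ext <;> simp [leave_apply, left_apply]
    · intro
      rw [family_ghost_exit, family_loop]
      exact LinearMap.ext fun p => by ext <;> simp [leave_apply, shift_apply]
    · intro h
      have h' : f' ≠ f := fun h' => h (congrArg Subtype.val h'.symm)
      rw [family_ghost_exit, family_exit]
      exact LinearMap.ext fun p => by ext <;> simp [leave_apply, enter_apply, h']
  · refine DirectedGraph.vert_cases (τ := τ) (E := E) (fun a => ?_) ?_
    · intro hfin hne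
      have himg : E.s ⁻¹' {a.1}
          = Subtype.val '' ((E.restrict {E.s τ}ᶜ hτ.hereditary).s ⁻¹' {a}) := by
        ext e
        constructor
        · intro h
          have h' : E.s e = a.1 := h
          exact ⟨⟨e, h' ▸ a.2⟩, Subtype.ext h', rfl⟩
        · rintro ⟨e', h, rfl⟩
          exact congrArg Subtype.val (show (E.restrict {E.s τ}ᶜ hτ.hereditary).s e' = a from h)
      have hfin' : ((E.restrict {E.s τ}ᶜ hτ.hereditary).s ⁻¹' {a}).Finite :=
        Set.Finite.of_finite_image (himg ▸ hfin) Subtype.val_injective.injOn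
      have : hfin.toFinset = hfin'.toFinset.map ⟨Subtype.val, Subtype.val_injective⟩ := by
        ext e; simp only [Set.Finite.mem_toFinset, himg]; simp
      rw [this, Finset.sum_map, hv, ck.regular_vert a hfin' (Set.image_nonempty.1 (himg ▸ hne)),
        left_sum]
      refine Finset.sum_congr rfl fun e _ => ?_
      change _ = family K hτ N (edge e.1) * family K hτ N (ghost e.1)
      rw [he, hg, left_mul]
    -- The relation at t: ττ* recovers the coordinates with n ≥ 1, and each ff* recovers the
    -- coordinate (0, f).
    · intro hfin _
      have hmem (e : Ed) : e ∈ hfin.toFinset ↔ E.s e = E.s τ := by simp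
      have hloop (p : ExitModule E τ N) :
          (family K hτ N (edge τ) * family K hτ N (ghost τ)) p
            = (0, fun n f => n.casesOn 0 fun n => exitVert K hτ f • p.2 (n + 1) f) := by
        rw [family_loop, family_ghost_loop]
        ext (_ | n) <;> simp [unshift_apply, shift_apply, exitVert_smul_smul]
      have hexit (f : E.Exit τ) (p : ExitModule E τ N) :
          (family K hτ N (edge f.1) * family K hτ N (ghost f.1)) p = (0, fun n f' =>
            n.casesOn (if f = f' then exitVert K hτ f • p.2 0 f else 0) fun _ => 0) := by
        rw [family_exit, family_ghost_exit]
        ext (_ | n) <;> simp [leave_apply, enter_apply, exitVert_smul_smul]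
      rw [family_source]
      refine LinearMap.ext fun p => ?_
      rw [LinearMap.sum_apply]
      have hexit' (e : Ed) (h1 : E.s e = E.s τ) (h2 : e ≠ τ) := hexit ⟨e, h1, h2⟩ p
      refine Prod.ext ?_ (funext fun n => funext fun f => ?_)
      · rw [Prod.fst_sum]
        symm
        refine Finset.sum_eq_zero fun e h => ?_
        by_cases h2 : e = τ
        · rw [h2, hloop]
        · rw [hexit' e ((hmem e).1 h) h2]
      · rw [Prod.snd_sum, Finset.sum_apply, Finset.sum_apply]
        cases n with
        | zero =>
          rw [Finset.sum_eq_single_of_mem f.1 ((hmem _).2 f.2.1), hexit f]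
          · simp [proj_apply]
          · intro e h hef
            by_cases h2 : e = τ
            · rw [h2, hloop]
              rfl
            · rw [hexit' e ((hmem e).1 h) h2]
              exact if_neg fun h' => hef (congrArg Subtype.val h')
        | succ n =>
          rw [Finset.sum_eq_single_of_mem τ ((hmem _).2 rfl), hloop]
          · simp [proj_apply]
          · intro e h h2
            rw [hexit' e ((hmem e).1 h) h2]

variable (N) in
/-- The representation of `L_K(E)` induced by a module over the restricted algebra. -/
noncomputable def rep : LeavittPathAlgebra K E →ₙₐ[K] Module.End K (ExitModule E τ N) :=
  lift K (family K hτ N) (isCuntzKriegerFamily_family K hτ)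

theorem rep_restrictHom (a : LeavittPathAlgebra K (E.restrict {E.s τ}ᶜ hτ.hereditary)) :
    rep K hτ N (restrictHom K hτ.hereditary a) = left K hτ a := by
  have hgen (g) : rep K hτ N (restrictHom K hτ.hereditary (gen K _ g)) = left K hτ (gen K _ g) := by
    rw [restrictHom_gen, rep, lift_gen, family_restrictGen]
  induction a using LeavittPathAlgebra.induction with
  | zero => rw [map_zero, map_zero, left_zero]
  | add p q hp hq =>
    rw [map_add, map_add, hp, hq]
    exact LinearMap.ext fun p => by simp [left_apply, add_smul]
  | smul c p hp =>
    rw [map_smul, map_smul, hp]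
    exact LinearMap.ext fun p => by simp [left_apply]
  | gen g => exact hgen g
  | gen_mul g p hp => rw [map_mul, map_mul, hp, hgen, left_mul]

end ExitModule

/-- Let φ(a) act on the module induced from N = R: the vector (1, 0) goes to (a, 0), so a can be
read off. -/
theorem restrictHom_injective : Function.Injective (restrictHom K hτ.hereditary) := by
  intro a b hab
  have h := congrArg (fun z => (ExitModule.rep K hτ
    (LeavittPathAlgebra K (E.restrict {E.s τ}ᶜ hτ.hereditary)) z (1, 0)).1) hab
  simpa [ExitModule.rep_restrictHom, ExitModule.left_apply] using h

/-- Both frames are indexed by ρ and the pairs (n, f), and the homomorphism sends one to the other.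
-/
theorem hedgehogToIdeal_bijective : Function.Bijective (hedgehogToIdeal K hτ) := by
  refine (hedgehog_isCornerFrame K (E.restrict {E.s τ}ᶜ hτ.hereditary) _).bijective
    (exit_isCornerFrame K hτ)
    (hedgehogToIdeal K hτ : LeavittPathAlgebra K (exitHedgehog hτ) →ₙ+*
      vertexIdealAlgebra K E {E.s τ}ᶜ) (hedgehogToIdeal_hedgehogHom K hτ) ?_ ?_ ?_
  · rintro (_ | k)
    · exact hedgehogToIdeal_hedgehogHom K hτ 1
    · exact Subtype.ext (lift_gen K _ (isCuntzKriegerFamily_hedgehogFamily K hτ) _)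
  · rintro (_ | k)
    · exact hedgehogToIdeal_hedgehogHom K hτ 1
    · exact Subtype.ext (lift_gen K _ (isCuntzKriegerFamily_hedgehogFamily K hτ) _)
  · intro a b hab
    exact restrictHom_injective K hτ (congrArg Subtype.val hab)

/-- The functor `M ↦ ρ M` is an equivalence from the unitary modules over the ideal generated by
`ρ` to the modules over the restricted algebra. -/
theorem cornerFunctor_isEquivalence :
    (UnitaryModuleCat.cornerFunctor.{max u v w, max u v w, max u v w}
      (restrictHomIdeal K hτ : LeavittPathAlgebra K (E.restrict {E.s τ}ᶜ hτ.hereditary) →ₙ+*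
        vertexIdealAlgebra K E {E.s τ}ᶜ)).IsEquivalence where
  faithful := UnitaryModuleCat.cornerFunctor_faithful (exit_isCornerFrame K hτ)
  full := UnitaryModuleCat.cornerFunctor_full (exit_isCornerFrame K hτ)
  essSurj := by
    refine UnitaryModuleCat.cornerFunctor_essSurj (exit_isCornerFrame K hτ) fun N => ?_
    -- N is only given over R; its K-structure through K → R is needed to make the induced
    -- representation K-linear.
    let : Module K N := Module.compHom N
      (algebraMap K (LeavittPathAlgebra K (E.restrict {E.s τ}ᶜ hτ.hereditary)))
    have : IsScalarTower K (LeavittPathAlgebra K (E.restrict {E.s τ}ᶜ hτ.hereditary)) N :=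
      IsScalarTower.of_algebraMap_smul fun r x => rfl
    -- On this module ρ acts as the projection to the first factor, so the corner is N.
    refine ⟨ExitModule E τ N, inferInstance,
      { toFun := fun b => (ExitModule.rep K hτ N b.1).toAddMonoidHom
        map_mul' := fun a b => AddMonoidHom.ext fun p => by
          change ExitModule.rep K hτ N (a.1 * b.1) p = _
          rw [map_mul]; rfl
        map_zero' := AddMonoidHom.ext fun p => by
          change ExitModule.rep K hτ N 0 p = _
          rw [map_zero]; rfl
        map_add' := fun a b => AddMonoidHom.ext fun p => by
          change ExitModule.rep K hτ N (a.1 + b.1) p = _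
          rw [map_add]; rfl }, AddMonoidHom.inl N _, ?_, ?_, ?_⟩
    · exact fun m n h => congrArg Prod.fst h
    · intro a n
      change _ = ExitModule.rep K hτ N (restrictHom K hτ.hereditary a) _
      rw [ExitModule.rep_restrictHom]
      rfl
    · intro p
      refine ⟨p.1, ?_⟩
      change _ = ExitModule.rep K hτ N (restrictHom K hτ.hereditary 1) p
      rw [ExitModule.rep_restrictHom, ExitModule.left_apply, one_smul]
      rfl

end ExitModule

end LeavittPathAlgebra

/-! ### Left ideals contained in I. -/

namespace LeavittPathAlgebra

section LeftIdeals

variable (K : Type u) [Field K] {V : Type v} {Ed : Type w} [Finite V] {E : DirectedGraph V Ed}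
  {τ : Ed} (hτ : E.IsSourceLoop τ)

theorem mem_vertexSumIdeal_iff {z : LeavittPathAlgebra K E} :
    z ∈ vertexSumIdeal K E {E.s τ}ᶜ ↔
      z ∈ vertexIdeal K E {E.s τ}ᶜ ∧ restrictHom K hτ.hereditary 1 * z = z := by
  rw [restrictHom_one]
  constructor
  · rintro ⟨y, hy, rfl⟩
    exact ⟨(vertexIdeal K E _).mul_mem_left _ _ hy, by rw [← mul_assoc, vertexSum_mul_self]⟩
  · rintro ⟨hz, h⟩
    exact ⟨z, hz, h.symm⟩

/-- The lattice isomorphism between the left ideals contained in the ideal generated by `ρ` and the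
submodules of `ρI` over the restricted algebra. -/
noncomputable def leftIdealOrderIso :
    {J : Ideal (LeavittPathAlgebra K E) // J ≤ (vertexIdeal K E {E.s τ}ᶜ).asIdeal} ≃o
      Submodule (LeavittPathAlgebra K (E.restrict {E.s τ}ᶜ hτ.hereditary))
        (vertexSumIdeal K E {E.s τ}ᶜ) := by
  refine Equiv.toOrderIso
    { toFun := fun J =>
        { carrier := {z | z.1 ∈ J.1}
          add_mem' := fun ha hb => J.1.add_mem ha hb
          zero_mem' := J.1.zero_mem
          smul_mem' := fun a z hz => J.1.mul_mem_left (restrictHom K hτ.hereditary a) hz }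
      invFun := fun N => ⟨Ideal.span (Subtype.val '' (N : Set (vertexSumIdeal K E {E.s τ}ᶜ))), by
        rw [Ideal.span_le]
        rintro _ ⟨z, -, rfl⟩
        exact ((mem_vertexSumIdeal_iff K hτ).1 z.2).1⟩
      left_inv := ?_
      right_inv := ?_ } ?_ ?_
  · rintro ⟨J, hJ⟩
    refine Subtype.ext (le_antisymm ?_ fun j hj => ?_)
    · rw [Ideal.span_le]
      rintro _ ⟨z, hz, rfl⟩
      exact hz
    -- J is recovered from J ∩ ρI because j = ∑ x_k (y_k j) and each y_k j = ρ y_k j belongs to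
    -- both.
    · obtain ⟨s, hs⟩ := (exit_left_unit K hτ (hJ hj)).exists
      rw [← hs, Finset.sum_mul]
      refine Ideal.sum_mem _ fun k _ => ?_
      rw [mul_assoc]
      have hk : exitRight K hτ k * j ∈ vertexSumIdeal K E {E.s τ}ᶜ := by
        rw [mem_vertexSumIdeal_iff K hτ]
        refine ⟨(vertexIdeal K E _).mul_mem_left _ _ (hJ hj), ?_⟩
        rw [← mul_assoc, restrictHom_one_mul_exitRight]
      have hk' : exitRight K hτ k * j ∈ Subtype.val ''
          {z : vertexSumIdeal K E {E.s τ}ᶜ | z.1 ∈ J} := ⟨⟨_, hk⟩, J.mul_mem_left _ hj, rfl⟩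
      exact Ideal.mul_mem_left _ _ (Ideal.subset_span hk')
  · intro N
    refine le_antisymm ?_ fun z hz => Ideal.subset_span (Set.mem_image_of_mem Subtype.val hz)
    intro z hz
    change z.1 ∈ Ideal.span _ at hz
    -- This says ρLN ⊆ N, a consequence of ρLρ = φ(R). Quantifying over b lets the induction absorb
    -- left multipliers; b = 1 then gives z = ρz ∈ N.
    have key : ∀ b, ∃ n ∈ N, restrictHom K hτ.hereditary 1 * b * z.1 = n.1 := by
      generalize z.1 = y at hz
      induction hz using Submodule.span_induction with
      | mem y hy =>
        obtain ⟨n, hn, rfl⟩ := hy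
        intro b
        obtain ⟨a, ha⟩ := exit_corner K hτ b
        refine ⟨a • n, N.smul_mem a hn, ?_⟩
        conv_lhs => rw [← ((mem_vertexSumIdeal_iff K hτ).1 n.2).2, ← mul_assoc, ha]
        rfl
      | zero => exact fun b => ⟨0, N.zero_mem, mul_zero _⟩
      | add p q _ _ hp hq =>
        intro b
        obtain ⟨m, hm, hm'⟩ := hp b
        obtain ⟨n, hn, hn'⟩ := hq b
        exact ⟨m + n, N.add_mem hm hn, by rw [mul_add, hm', hn']; rfl⟩
      | smul c p _ hp =>
        intro b
        obtain ⟨m, hm, hm'⟩ := hp (b * c)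
        exact ⟨m, hm, by rw [← hm', smul_eq_mul]; simp only [mul_assoc]⟩
    obtain ⟨n, hn, h⟩ := key 1
    rw [mul_one, ((mem_vertexSumIdeal_iff K hτ).1 z.2).2] at h
    rwa [Subtype.ext h]
  · exact fun J J' h z hz => h hz
  · exact fun N N' h => Ideal.span_mono (Set.image_mono h)

/-! ### The quotient L/I and the left ideals above I. -/

/-- The quotient map by the ideal generated by the vertices different from the base of the loop. -/
noncomputable abbrev toLoopQuotient (E : DirectedGraph V Ed) (τ : Ed) :
    LeavittPathAlgebra K E →+* (vertexIdeal K E {E.s τ}ᶜ).ringCon.Quotient :=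
  (vertexIdeal K E {E.s τ}ᶜ).ringCon.mk'

theorem toLoopQuotient_eq_iff {a b : LeavittPathAlgebra K E} :
    toLoopQuotient K E τ a = toLoopQuotient K E τ b ↔ a - b ∈ vertexIdeal K E {E.s τ}ᶜ := by
  rw [← TwoSidedIdeal.rel_iff]
  exact RingCon.eq _

theorem toLoopQuotient_eq_zero_iff {a : LeavittPathAlgebra K E} :
    toLoopQuotient K E τ a = 0 ↔ a ∈ vertexIdeal K E {E.s τ}ᶜ := by
  rw [← map_zero (toLoopQuotient K E τ), toLoopQuotient_eq_iff, sub_zero]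

theorem toLoopQuotient_vert {a : V} (ha : a ≠ E.s τ) :
    toLoopQuotient K E τ (gen K E (vert a)) = 0 := by
  rw [toLoopQuotient_eq_zero_iff]
  have : gen K E (vert a) = gen K E (vert a) * vertexSum K E {E.s τ}ᶜ :=
    (ofVert_mul_vertexSum K E _ ha).symm
  rw [this]
  exact (vertexIdeal K E _).mul_mem_left _ _ (TwoSidedIdeal.subset_span rfl)

theorem toLoopQuotient_source : toLoopQuotient K E τ (gen K E (vert (E.s τ))) = 1 := by
  rw [← map_one (toLoopQuotient K E τ), one_def, vertexSum, map_sum,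
    Finset.sum_eq_single_of_mem (E.s τ) (by simp)]
  · rfl
  · exact fun a _ ha => toLoopQuotient_vert K ha

-- An edge other than τ ends in H, so it equals e r(e) with r(e) ∈ I.
include hτ in
theorem toLoopQuotient_edge {e : Ed} (he : e ≠ τ) :
    toLoopQuotient K E τ (gen K E (edge e)) = 0 := by
  rw [← (isCuntzKriegerFamily_gen K E).edge_range, map_mul,
    toLoopQuotient_vert K fun h => he (hτ.2 e h), mul_zero]

include hτ in
theorem toLoopQuotient_ghost {e : Ed} (he : e ≠ τ) :
    toLoopQuotient K E τ (gen K E (ghost e)) = 0 := by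
  rw [← (isCuntzKriegerFamily_gen K E).range_ghost, map_mul,
    toLoopQuotient_vert K fun h => he (hτ.2 e h), zero_mul]

include hτ in
theorem toLoopQuotient_ghost_mul_loop : toLoopQuotient K E τ (gen K E (ghost τ)) *
    toLoopQuotient K E τ (gen K E (edge τ)) = 1 := by
  rw [← map_mul, (isCuntzKriegerFamily_gen K E).ghost_edge_self, ← hτ.1, toLoopQuotient_source]

-- Modulo I, the Cuntz-Krieger relation at t loses every summand except ττ*, and t becomes the
-- identity.
include hτ in
theorem toLoopQuotient_loop_mul_ghost [Finite Ed] : toLoopQuotient K E τ (gen K E (edge τ)) *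
    toLoopQuotient K E τ (gen K E (ghost τ)) = 1 := by
  have hfin : (E.s ⁻¹' {E.s τ}).Finite := Set.toFinite _
  rw [← toLoopQuotient_source, (isCuntzKriegerFamily_gen K E).regular_vert _ hfin ⟨τ, rfl⟩, map_sum,
    Finset.sum_eq_single_of_mem τ (by simp), map_mul]
  intro e _ he
  rw [map_mul, toLoopQuotient_edge K hτ he, zero_mul]

-- The quotient is generated by τ and its inverse, so each class is a Laurent polynomial in τ; a
-- power of τ clears the denominators.
include hτ in
theorem exists_pow_mul_eq_aeval [Finite Ed] (a : LeavittPathAlgebra K E) :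
    ∃ (n : ℕ) (p : Polynomial K), toLoopQuotient K E τ (ofEdge K E τ) ^ n * toLoopQuotient K E τ a
      = toLoopQuotient K E τ (Polynomial.aeval (ofEdge K E τ) p) := by
  have hgen (g) : toLoopQuotient K E τ (gen K E g) = 0 ∨ toLoopQuotient K E τ (gen K E g) = 1 ∨
      g = edge τ ∨ g = ghost τ := by
    rcases g with a | e | e
    · by_cases h : a = E.s τ
      · subst h
        exact .inr (.inl (toLoopQuotient_source K))
      · exact .inl (toLoopQuotient_vert K h)
    · by_cases h : e = τ
      · exact .inr (.inr (.inl (h ▸ rfl)))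
      · exact .inl (toLoopQuotient_edge K hτ h)
    · by_cases h : e = τ
      · exact .inr (.inr (.inr (h ▸ rfl)))
      · exact .inl (toLoopQuotient_ghost K hτ h)
  have hmul (g a) (ha : ∃ (n : ℕ) (p : Polynomial K),
      toLoopQuotient K E τ (ofEdge K E τ) ^ n * toLoopQuotient K E τ a
        = toLoopQuotient K E τ (Polynomial.aeval (ofEdge K E τ) p)) :
      ∃ (n : ℕ) (p : Polynomial K),
        toLoopQuotient K E τ (ofEdge K E τ) ^ n * toLoopQuotient K E τ (gen K E g * a)
          = toLoopQuotient K E τ (Polynomial.aeval (ofEdge K E τ) p) := by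
    obtain ⟨n, p, hp⟩ := ha
    obtain h | h | rfl | rfl := hgen g
    · exact ⟨0, 0, by rw [map_mul, h, zero_mul, mul_zero, map_zero, map_zero]⟩
    · exact ⟨n, p, by rw [map_mul, h, one_mul, hp]⟩
    · refine ⟨n, Polynomial.X * p, ?_⟩
      rw [map_mul, map_mul, map_mul, Polynomial.aeval_X, ← hp, ← mul_assoc, ← mul_assoc]
      congr 1
      exact (pow_succ _ n).symm.trans (pow_succ' _ n)
    · refine ⟨n + 1, p, ?_⟩
      rw [map_mul, pow_succ, mul_assoc, ← mul_assoc _ (toLoopQuotient K E τ (gen K E (ghost τ)))]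
      erw [toLoopQuotient_loop_mul_ghost K hτ]
      rw [one_mul, hp]
  induction a using LeavittPathAlgebra.induction with
  | zero => exact ⟨0, 0, by simp⟩
  | add a b ha hb =>
    obtain ⟨n, p, hp⟩ := ha
    obtain ⟨m, q, hq⟩ := hb
    -- Bring both summands to the common exponent n + m.
    refine ⟨n + m, Polynomial.X ^ m * p + Polynomial.X ^ n * q, ?_⟩
    simp only [map_add, map_mul, map_pow, Polynomial.aeval_X, ← hp, ← hq, mul_add, ← mul_assoc,
      ← pow_add, add_comm m n]
  | smul c a ha =>
    obtain ⟨n, p, hp⟩ := ha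
    refine ⟨n, c • p, ?_⟩
    rw [map_smul (Polynomial.aeval (ofEdge K E τ)), Algebra.smul_def c a, Algebra.smul_def c
      (Polynomial.aeval (ofEdge K E τ) p), map_mul, map_mul, ← hp, ← mul_assoc,
      ← mul_assoc, ← map_pow, ← map_mul, ← map_mul (toLoopQuotient K E τ) (algebraMap _ _ c),
      Algebra.commutes c (ofEdge K E τ ^ n)]
  | gen g =>
    have := hmul g 1 ⟨0, 1, by simp⟩
    rwa [mul_one] at this
  | gen_mul g a ha => exact hmul g a ha

/-- Polynomials in τ commute, so the left ideal L p(τ) is also stable under right multiplication by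
them. -/
theorem aeval_loop_mul_mem_span (p q : Polynomial K) {z : LeavittPathAlgebra K E}
    (hz : z ∈ Ideal.span {Polynomial.aeval (ofEdge K E τ) p}) :
    z * Polynomial.aeval (ofEdge K E τ) q ∈ Ideal.span {Polynomial.aeval (ofEdge K E τ) p} := by
  obtain ⟨b, rfl⟩ := Ideal.mem_span_singleton'.1 hz
  rw [mul_assoc, ← map_mul, mul_comm p, map_mul, ← mul_assoc]
  exact Ideal.mul_mem_left _ _ (Ideal.mem_span_singleton_self _)

include hτ in
theorem vertexIdeal_le_span_aeval {p : Polynomial K} (hp : p.eval 0 = 1) :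
    (vertexIdeal K E {E.s τ}ᶜ).asIdeal ≤ Ideal.span {Polynomial.aeval (ofEdge K E τ) p} := by
  obtain ⟨q, hq⟩ : Polynomial.X ∣ p - 1 := by
    rw [Polynomial.X_dvd_iff, Polynomial.coeff_zero_eq_eval_zero, Polynomial.eval_sub, hp,
      Polynomial.eval_one, sub_self]
  -- With p = 1 + xq, z = z p(τ) − zτ q(τ). Hence z ∈ L p(τ) as soon as zτ is.
  have hpq (z : LeavittPathAlgebra K E) : z = z * Polynomial.aeval (ofEdge K E τ) p
      - z * ofEdge K E τ * Polynomial.aeval (ofEdge K E τ) q := by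
    rw [eq_add_of_sub_eq hq, map_add, map_one, map_mul, Polynomial.aeval_X, mul_add, mul_one,
      mul_assoc, add_sub_cancel_left]
  have hz {z : LeavittPathAlgebra K E}
      (h : z * ofEdge K E τ ∈ Ideal.span {Polynomial.aeval (ofEdge K E τ) p}) :
      z ∈ Ideal.span {Polynomial.aeval (ofEdge K E τ) p} := by
    rw [hpq z]
    exact sub_mem (Ideal.mul_mem_left _ _ (Ideal.mem_span_singleton_self _))
      (aeval_loop_mul_mem_span K p q h)
  -- Induct along the ghost paths: τ takes f*(τ*)^(n+1) to f*(τ*)^n and kills both f* and ρ.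
  have hy (k) : exitRight K hτ k ∈ Ideal.span {Polynomial.aeval (ofEdge K E τ) p} := by
    rcases k with _ | ⟨n, f⟩
    · refine hz ?_
      have : exitRight K hτ none * ofEdge K E τ = 0 :=
        restrictHom_one_mul_eq_zero hτ ((isCuntzKriegerFamily_gen K E).source_edge τ)
      rw [this]
      exact zero_mem _
    · change exitGhost K f n ∈ _
      induction n with
      | zero =>
        refine hz ?_
        have : exitGhost K f 0 * ofEdge K E τ = 0 := exitGhost_zero_mul_loop K f
        rw [this]
        exact zero_mem _
      | succ n ih =>
        refine hz ?_
        have : exitGhost K f (n + 1) * ofEdge K E τ = exitGhost K f n :=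
          exitGhost_succ_mul_loop K hτ f n
        rwa [this]
  intro z h
  obtain ⟨s, hs⟩ := (exit_right_unit K hτ h).exists
  rw [← hs, Finset.mul_sum]
  refine Ideal.sum_mem _ fun k _ => ?_
  rw [← mul_assoc]
  exact Ideal.mul_mem_left _ _ (hy k)

include hτ in
/-- A left ideal that properly contains the ideal generated by the vertices different from the base
of a source loop is generated by a polynomial in the loop. -/
theorem exists_eq_span_aeval [Finite Ed] {J : Ideal (LeavittPathAlgebra K E)}
    (hJ : (vertexIdeal K E {E.s τ}ᶜ).asIdeal < J) :
    ∃ p : Polynomial K, p.eval 0 = 1 ∧ J = Ideal.span {Polynomial.aeval (ofEdge K E τ) p} := by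
  have hwu := toLoopQuotient_ghost_mul_loop K hτ
  have hpow (n : ℕ) (b) : toLoopQuotient K E τ (gen K E (ghost τ)) ^ n *
      (toLoopQuotient K E τ (ofEdge K E τ) ^ n * b) = b := by
    rw [← mul_assoc]
    erw [pow_mul_pow_eq_one n hwu]
    rw [one_mul]
  -- Since I ⊆ J, membership in J depends only on the class modulo I.
  have hcongr {a b : LeavittPathAlgebra K E} (hb : b ∈ J)
      (h : toLoopQuotient K E τ a = toLoopQuotient K E τ b) : a ∈ J := by
    rw [← sub_add_cancel a b]
    exact J.add_mem (hJ.le ((toLoopQuotient_eq_iff K).1 h)) hb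
  let P : Ideal (Polynomial K) := J.comap (Polynomial.aeval (ofEdge K E τ))
  have hP {p : Polynomial K} : p ∈ P ↔ Polynomial.aeval (ofEdge K E τ) p ∈ J := Iff.rfl
  have hJP {a} (ha : a ∈ J) {n : ℕ} {p : Polynomial K}
      (h : toLoopQuotient K E τ (ofEdge K E τ) ^ n * toLoopQuotient K E τ a
        = toLoopQuotient K E τ (Polynomial.aeval (ofEdge K E τ) p)) : p ∈ P := by
    refine hP.2 (hcongr (J.mul_mem_left (ofEdge K E τ ^ n) ha) ?_)
    rw [← h, map_mul, map_pow]
  obtain ⟨q, hq⟩ := (IsPrincipalIdealRing.principal P).principal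
  replace hq : P = Ideal.span {q} := hq
  have hqP : q ∈ P := hq ▸ Ideal.mem_span_singleton_self q
  -- An element of J outside I has a nonzero class, and τ is invertible there, so it yields a
  -- nonzero polynomial in P.
  have hq0 : q ≠ 0 := by
    rintro rfl
    obtain ⟨a, ha, haI⟩ := SetLike.exists_of_lt hJ
    obtain ⟨n, p, h⟩ := exists_pow_mul_eq_aeval K hτ a
    have hp := hJP ha h
    rw [hq, Ideal.mem_span_singleton, zero_dvd_iff] at hp
    refine haI ((toLoopQuotient_eq_zero_iff K).1 ?_)
    rw [← hpow n (toLoopQuotient K E τ a), h, hp, map_zero, map_zero, mul_zero]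
  -- Multiplying by τ* on the left cancels x modulo I.
  have hX {p : Polynomial K} (hp : Polynomial.X * p ∈ P) : p ∈ P := by
    rw [hP, map_mul, Polynomial.aeval_X] at hp
    refine hP.2 (hcongr (J.mul_mem_left (gen K E (ghost τ)) hp) ?_)
    rw [map_mul, map_mul]
    simpa using (hpow 1 (toLoopQuotient K E τ (Polynomial.aeval (ofEdge K E τ) p))).symm
  -- If q = xp, then p ∈ P is itself a multiple of q, which would make x a unit.
  have hc : q.eval 0 ≠ 0 := by
    intro h
    obtain ⟨p, rfl⟩ : Polynomial.X ∣ q := by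
      rwa [Polynomial.X_dvd_iff, Polynomial.coeff_zero_eq_eval_zero]
    have hp := hX hqP
    rw [hq, Ideal.mem_span_singleton] at hp
    obtain ⟨r, hr⟩ := hp
    have hp0 : p ≠ 0 := right_ne_zero_of_mul hq0
    refine Polynomial.not_isUnit_X (R := K) (IsUnit.of_mul_eq_one r (mul_right_cancel₀ hp0 ?_))
    rw [one_mul]
    conv_rhs => rw [hr]
    ring
  have hp1 : (Polynomial.C (q.eval 0)⁻¹ * q).eval 0 = 1 := by
    rw [Polynomial.eval_mul, Polynomial.eval_C, inv_mul_cancel₀ hc]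
  refine ⟨Polynomial.C (q.eval 0)⁻¹ * q, hp1, le_antisymm (fun a ha => ?_) ?_⟩
  · obtain ⟨n, p, h⟩ := exists_pow_mul_eq_aeval K hτ a
    have hp := hJP ha h
    rw [hq, Ideal.mem_span_singleton] at hp
    obtain ⟨r, rfl⟩ := hp
    have hr : q * r = Polynomial.C (q.eval 0) * r * (Polynomial.C (q.eval 0)⁻¹ * q) := by
      have hC : Polynomial.C (q.eval 0) * Polynomial.C (q.eval 0)⁻¹ = 1 := by
        rw [← Polynomial.C_mul, mul_inv_cancel₀ hc, Polynomial.C_1]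
      linear_combination (-(q * r)) * hC
    have hmem : gen K E (ghost τ) ^ n * Polynomial.aeval (ofEdge K E τ) (q * r) ∈
        Ideal.span {Polynomial.aeval (ofEdge K E τ) (Polynomial.C (q.eval 0)⁻¹ * q)} := by
      rw [hr, map_mul _ (Polynomial.C (q.eval 0) * r), ← mul_assoc]
      exact Ideal.mul_mem_left _ _ (Ideal.mem_span_singleton_self _)
    -- Modulo I, a equals (τ*)^n (qr)(τ); the difference lies in I, hence in the left ideal
    -- generated by the normalised polynomial at τ.
    rw [← sub_add_cancel a (gen K E (ghost τ) ^ n * Polynomial.aeval (ofEdge K E τ) (q * r))]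
    refine add_mem (vertexIdeal_le_span_aeval K hτ hp1 ((toLoopQuotient_eq_iff K).1 ?_)) hmem
    rw [map_mul, map_pow, ← h, hpow]
  · rw [Ideal.span_singleton_le_iff_mem]
    exact P.mul_mem_left _ hqP

end LeftIdeals

end LeavittPathAlgebra

theorem proposition2p1 {K : Type u} [Field K] {V : Type v} {Ed : Type w} [Finite V] [Finite Ed]
    (E : DirectedGraph V Ed) (τ : Ed) (hτ : E.IsSourceLoop τ) :
    -- `I` is isomorphic, as a `K`-algebra, to a Leavitt path algebra
    (∃ (F₀ : Type (max v w)) (F₁ : Type w) (F : DirectedGraph F₀ F₁)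
      (f : LeavittPathAlgebra K F →ₙₐ[K] LeavittPathAlgebra.vertexIdealAlgebra K E {E.s τ}ᶜ),
      Function.Bijective f) ∧
    -- `I` is Morita equivalent to `L_K(E_H)`
    Nonempty
      (UnitaryModuleCat.{max u v w, max u v w}
          (LeavittPathAlgebra.vertexIdealAlgebra K E {E.s τ}ᶜ) ≌
        ModuleCat.{max u v w} (LeavittPathAlgebra K (E.restrict {E.s τ}ᶜ hτ.hereditary))) ∧
    -- the left ideals contained in `I` and the `L_K(E_H)`-submodules of `ρI`
    Nonempty
      ({J : Ideal (LeavittPathAlgebra K E) //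
          J ≤ (LeavittPathAlgebra.vertexIdeal K E {E.s τ}ᶜ).asIdeal} ≃o
        Submodule (LeavittPathAlgebra K (E.restrict {E.s τ}ᶜ hτ.hereditary))
          (LeavittPathAlgebra.vertexSumIdeal K E {E.s τ}ᶜ)) ∧
    -- the left ideals properly containing `I`
    (∀ J : Ideal (LeavittPathAlgebra K E),
      (LeavittPathAlgebra.vertexIdeal K E {E.s τ}ᶜ).asIdeal < J →
        ∃ p : Polynomial K, p.eval 0 = 1 ∧
          J = Ideal.span {Polynomial.aeval (LeavittPathAlgebra.ofEdge K E τ) p}) := by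
  refine ⟨⟨_, _, _, LeavittPathAlgebra.hedgehogToIdeal K hτ,
    LeavittPathAlgebra.hedgehogToIdeal_bijective K hτ⟩, ⟨?_⟩,
    ⟨LeavittPathAlgebra.leftIdealOrderIso K hτ⟩,
    fun J hJ => LeavittPathAlgebra.exists_eq_span_aeval K hτ hJ⟩
  have := LeavittPathAlgebra.cornerFunctor_isEquivalence K hτ
  exact (UnitaryModuleCat.cornerFunctor
    (LeavittPathAlgebra.restrictHomIdeal K hτ :
      LeavittPathAlgebra K (E.restrict {E.s τ}ᶜ hτ.hereditary) →ₙ+*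
        LeavittPathAlgebra.vertexIdealAlgebra K E {E.s τ}ᶜ)).asEquivalence
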